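/- Throughout, $\log$ denotes the base-2 logarithm. For $n,r\in\mathbb N$ let $\mathbb M_{n,r}$ be the set of matroids of rank $r$ with ground set $\{1,\dots,n\}$, let $\mathbb M_n=\bigcup_{r}\mathbb M_{n,r}$ be the set of all matroids with ground set $\{1,\dots,n\}$, let $\mathbb M=\bigcup_n\mathbb M_n$, and let $m(n)=|\mathbb M_n|$. For a matroid $M$ let $W(M)$ denote the set of all circuit-hyperplanes of $M$, i.e. of all subsets of the ground set that are both a circuit and a hyperplane (a flat of rank $r(M)-1$) of $M$. A set $\mathcal M\subseteq\mathbb M$ is called thin if $|\mathcal M\cap\mathbb M_n|/|\mathbb M_n|\to 0$ as $n\to\infty$. There is a constant $c>0$ such that the following holds for every class of matroids $\mathcal M\subseteq\mathbb M$. If there is an $n_0$ such that $$\log\bigl|\{W(M): M\in\mathcal M\cap\mathbb M_{n,r}\}\bigr|\le\Bigl(1-c\,\frac{\log(n)^3}{n}\Bigr)\log m(n)$$ for all $n\ge n_0$ and all $0\le r\le n$ (the inequality being regarded as satisfied if $\mathcal M\cap\mathbb M_{n,r}$ is empty), then $\mathcal M$ is thin. -/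

import Mathlib

open Filter Topology

namespace MatroidAsymptotics

/-- The set of all matroids with ground set `[n] = {1, …, n}`. -/
def matroids (n : ℕ) : Set (Matroid ℕ) :=
  {M | M.E = Set.Icc 1 n}

/-- The set of all matroids with ground set `[n] = {1, …, n}` and rank `r`. -/
def matroidsOfRank (n r : ℕ) : Set (Matroid ℕ) :=
  {M | M.E = Set.Icc 1 n ∧ M.eRank = (r : ℕ∞)}

/-- The set of all matroids whose ground set is `[n]` for some natural number `n`. -/
def allMatroids : Set (Matroid ℕ) :=
  ⋃ n, matroids n

/-- There are finitely many matroids on `[n]`, so that `Set.ncard` is the true cardinality of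
`matroids n` and of each of its subsets. -/
theorem matroids_finite (n : ℕ) : (matroids n).Finite :=
  Matroid.finite_setOfPred_matroid' (Set.finite_Icc 1 n)

/-- The number `m(n)` of matroids with ground set `[n]`. -/
noncomputable def numMatroids (n : ℕ) : ℕ :=
  (matroids n).ncard

/-- A hyperplane of a matroid `M` (of finite rank) is a flat of rank `r(M) - 1`. -/
def IsHyperplane (M : Matroid ℕ) (H : Set ℕ) : Prop :=
  M.IsFlat H ∧ M.eRk H + 1 = M.eRank

/-- `W(M)`: the set of all circuit-hyperplanes of `M`, i.e. of all sets that are both a circuit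
and a hyperplane of `M`. -/
def circuitHyperplanes (M : Matroid ℕ) : Set (Set ℕ) :=
  {X | M.IsCircuit X ∧ IsHyperplane M X}

/-- A class of matroids is thin if the proportion of the matroids on `[n]` that it contains tends
to `0` as `n → ∞`. -/
def Thin (𝓜 : Set (Matroid ℕ)) : Prop :=
  Tendsto (fun n : ℕ => ((𝓜 ∩ matroids n).ncard : ℝ) / (numMatroids n : ℝ)) atTop (𝓝 0)

end MatroidAsymptotics

/-!
Write `N` for the central binomial coefficient `n.choose (n / 2)` and `ℓ` for `log n`, and fix a
rank `r`. The idea is to encode a matroid `M` on `{1, …, n}` by a short signature, its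
circuit-hyperplanes, and a family of sets which is either so large that `M` is untypical or so small
that it is cheap to record.

The *signature* (`fullSignature`) consists, for `M` and for its dual, of the circuits with at most
`s = n / 8` elements, and of data that determine the hyperplanes containing a set of nullity two
without such circuits. A hyperplane of the latter kind contains order `s ^ 2` bases for each
recorded datum, so that few data are recorded (`card_seedExtensions_mul_le`), and there are only
`2 ^ O(N ℓ / n ^ 2)` signatures (`card_signatureRange_le`). The `r`-sets whose status (basis or not) is
left open by the signature of `M`, and which are nonbases of `M`, are called *ambiguous*. Two sets
are *linked* if all matroids with the given signature agree on them. Exchanging elements along a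
short circuit or cocircuit gives linked sets; hence ambiguous sets adjacent in the Johnson graph are
linked (`JohnsonAdj.linked`), and, if `M` has no loops and coloops, an ambiguous set that is not a
circuit-hyperplane is linked to some other set (`exists_linked_ne`). Together with the signature,
one ambiguous set from each link class determines `M`.

Let `T` be the number of link classes of ambiguous sets with more than one member.

* If `T` is at least a threshold `t`, then choosing one of two members in each of these classes
  gives `2 ^ t` stable sets of the Johnson graph, and `M` can be recovered from each of them and its
  signature (`card_mul_two_pow_le`). As stable sets correspond to sparse paving matroids
  (`card_stableFamilies_le`), such `M` are rare if `2 ^ t` is much larger than the number of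
  signatures; `t` of order `N ℓ / n ^ 2` will do.
* Otherwise, `M` is determined by its signature, its circuit-hyperplanes, and at most `t`
  representatives (`card_le_mul_card_image_circuitHyperplanes`). The signature and the
  representatives take `O(N ℓ ^ 2 / n ^ 2)` bits, whereas the hypothesis saves
  `(ℓ ^ 3 / n) log m(n)` bits, which is at least `N ℓ ^ 3 / n ^ 2` by the bound `log m(n) ≥ N / n` of Graham and
  Sloane (`choose_div_le_logb_numMatroids`).

Matroids with a loop or a coloop are rare, since a loop can be placed freely in each flat spanned by
a subset of a basis (`card_isLoop_mul_two_pow_le`), and matroids of very small or very large rank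
are rare since they have few candidates for bases.
-/

/-! ### Spanning and exchange in matroids -/

open Set in
/-- Every element of a set `X` is spanned by the rest of `X`, or is spanned by the complement of `X`
in the dual matroid. -/
theorem Matroid.mem_closure_or_mem_dual_closure {α : Type*} (M : Matroid α) [M.Finite] {X : Set α}
    (hX : X ⊆ M.E) {u : α} (hu : u ∈ X) :
    u ∈ M.closure (X \ {u}) ∨ u ∈ M✶.closure (M.E \ X) := by
  by_contra! h
  have hfin : M.E.Finite := M.ground_finite
  have h1 := M.eRk_insert_eq_add_one (e := u) (X := X \ {u}) ⟨hX hu, h.1⟩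
  have h2 := M✶.eRk_insert_eq_add_one (e := u) (X := M.E \ X) ⟨hX hu, h.2⟩
  rw [insert_sdiff_singleton, insert_eq_of_mem hu] at h1
  have e1 := M.eRk_dual_add_eRank (M.E \ X) sdiff_subset
  have e2 := M.eRk_dual_add_eRank (insert u (M.E \ X)) (insert_subset (hX hu) sdiff_subset)
  have hc : M.E \ insert u (M.E \ X) = X \ {u} := by
    ext x; have := @hX x; simp; tauto
  rw [hc, encard_insert_of_notMem (fun h => h.2 hu), h2] at e2
  rw [sdiff_sdiff_right_self, inter_eq_self_of_subset_right hX, h1] at e1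
  have f1 : M.eRank ≠ ⊤ := M.eRank_ne_top_iff.2 inferInstance
  have f2 : M✶.eRk (M.E \ X) ≠ ⊤ :=
    ((M✶.eRk_le_encard _).trans_lt (hfin.subset sdiff_subset).encard_lt_top).ne
  have f3 : M.eRk (X \ {u}) ≠ ⊤ :=
    ((M.eRk_le_encard _).trans_lt (hfin.subset (sdiff_subset.trans hX)).encard_lt_top).ne
  have f4 : (M.E \ X).encard ≠ ⊤ := (hfin.subset sdiff_subset).encard_lt_top.ne
  lift M.eRank to ℕ using f1 with a
  lift M✶.eRk (M.E \ X) to ℕ using f2 with b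
  lift M.eRk (X \ {u}) to ℕ using f3 with c
  lift (M.E \ X).encard to ℕ using f4 with d
  norm_cast at e1 e2
  omega

/-- An element that does not raise the rank of a finite set lies in its closure. -/
theorem Matroid.mem_closure_of_eRk_insert_le {α : Type*} (M : Matroid α) {X : Set α}
    (hX : X.Finite) {y : α} (hy : y ∈ M.E) (h : M.eRk (insert y X) ≤ M.eRk X) :
    y ∈ M.closure X := by
  by_contra hc
  rw [M.eRk_insert_eq_add_one ⟨hy, hc⟩] at h
  have : M.eRk X ≠ ⊤ := ((M.eRk_le_encard _).trans_lt hX.encard_lt_top).ne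
  lift M.eRk X to ℕ using this with a
  norm_cast at h
  omega

/-- A set containing a circuit through `v` all of whose other elements lie in `X` spans the same as
`X`. -/
theorem Matroid.IsCircuit.mem_closure_of_subset_insert {α : Type*} {M : Matroid α} {C X : Set α}
    {v : α} (hC : M.IsCircuit C) (hv : v ∈ C) (hCX : C ⊆ insert v X) : v ∈ M.closure X :=
  M.closure_subset_closure (by simpa using hCX) (hC.mem_closure_sdiff_singleton_of_mem hv)

namespace MatroidAsymptotics

/-! ### Matroids of a given rank -/

section

variable {α : Type*}

/-- The matroids of rank `r` on the finite ground set `E`. -/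
def MatroidsOn (E : Finset α) (r : ℕ) : Set (Matroid α) :=
  {M | M.E = E ∧ M.eRank = (r : ℕ∞)}

/-- Adjacency in the Johnson graph: `Y` arises from `X` by exchanging one element. -/
def JohnsonAdj [DecidableEq α] (X Y : Finset α) : Prop :=
  ∃ u ∈ X, ∃ v ∉ X, Y = insert v (X.erase u)

theorem JohnsonAdj.ne [DecidableEq α] {X Y : Finset α} (h : JohnsonAdj X Y) : X ≠ Y := by
  obtain ⟨u, hu, v, hv, rfl⟩ := h
  intro h
  apply hv
  rw [h]
  simp

theorem MatroidsOn.finite {E : Finset α} {r : ℕ} {M : Matroid α} (hM : M ∈ MatroidsOn E r) :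
    M.Finite := ⟨hM.1 ▸ E.finite_toSet⟩

theorem MatroidsOn.dual {E : Finset α} {r : ℕ} {M : Matroid α} (hM : M ∈ MatroidsOn E r) :
    M✶ ∈ MatroidsOn E (E.card - r) := by
  refine ⟨hM.1, ?_⟩
  have h := M.eRank_add_eRank_dual
  rw [hM.1, hM.2, Set.encard_coe_eq_coe_finsetCard] at h
  have : M✶.eRank ≠ ⊤ := by
    intro h'
    rw [h'] at h
    simp at h
  lift M✶.eRank to ℕ using this with b
  norm_cast at h ⊢
  omega

theorem MatroidsOn.isBase_card {E : Finset α} {r : ℕ} {M : Matroid α} (hM : M ∈ MatroidsOn E r)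
    {X : Finset α} (hX : M.IsBase X) : X ∈ E.powersetCard r := by
  have h := hX.encard_eq_eRank
  rw [hM.2, Set.encard_coe_eq_coe_finsetCard] at h
  have h2 := hX.subset_ground
  rw [hM.1] at h2
  exact Finset.mem_powersetCard.2 ⟨by exact_mod_cast h2, by exact_mod_cast h⟩

theorem MatroidsOn.exists_finset {E : Finset α} {r : ℕ} {M : Matroid α} (hM : M ∈ MatroidsOn E r)
    {X : Set α} (hX : X ⊆ M.E) : ∃ Y : Finset α, (Y : Set α) = X := by
  rw [hM.1] at hX
  exact ⟨(E.finite_toSet.subset hX).toFinset, by simp⟩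

/-- Two matroids in `MatroidsOn E r` coincide if they have the same bases among the `r`-subsets. -/
theorem MatroidsOn.ext {E : Finset α} {r : ℕ} {M N : Matroid α} (hM : M ∈ MatroidsOn E r)
    (hN : N ∈ MatroidsOn E r) (h : ∀ X : Finset α, M.IsBase X ↔ N.IsBase X) : M = N := by
  refine Matroid.ext_isBase (hM.1.trans hN.1.symm) fun B hB => ?_
  obtain ⟨Y, rfl⟩ := MatroidsOn.exists_finset hM hB
  exact h Y

theorem MatroidsOn.isBase_iff_compl [DecidableEq α] {E : Finset α} {r : ℕ} {M : Matroid α}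
    (hM : M ∈ MatroidsOn E r) {X : Finset α} (hX : X ⊆ E) :
    M✶.IsBase ((E \ X : Finset α) : Set α) ↔ M.IsBase X := by
  rw [Matroid.dual_isBase_iff (by rw [hM.1]; simp), hM.1]
  simp [hX]

/-- `X` contains no circuit of `M` with at most `s` elements. -/
def NoShortCircuit (M : Matroid α) (s : ℕ) (X : Finset α) : Prop :=
  ∀ C : Finset α, C.card ≤ s → M.IsCircuit C → ¬ C ⊆ X

theorem NoShortCircuit.mono {M : Matroid α} {s : ℕ} {X Y : Finset α} (h : NoShortCircuit M s Y)
    (hXY : X ⊆ Y) : NoShortCircuit M s X :=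
  fun C hC hC' hCX => h C hC hC' (hCX.trans hXY)

end

/-! ### The signature of a matroid -/

section

variable {α : Type*} [DecidableEq α]

/-- `X` is an `r`-set of rank `r - 1` without short circuits, where `r` is the rank of `M`, and some
`insert y X` of the same rank still has no short circuit. The hyperplanes spanned by such sets
contain many bases, so there are few of them. -/
def IsSeed (M : Matroid α) (s : ℕ) (X : Finset α) : Prop :=
  (X : Set α) ⊆ M.E ∧ M.eRk X + 1 = X.card ∧ M.eRk X + 1 = M.eRank ∧
    ∃ y ∈ M.closure X, y ∉ X ∧ NoShortCircuit M s (insert y X)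

open Classical in
/-- A chosen seed spanning the flat `H`, if there is one. -/
noncomputable def seedOf (M : Matroid α) (s : ℕ) (H : Set α) : Finset α :=
  if h : ∃ X : Finset α, IsSeed M s X ∧ M.closure X = H then h.choose else ∅

open Classical in
/-- The circuits of `M` with at most `s` elements. -/
noncomputable def shortCircuits (M : Matroid α) (E : Finset α) (s : ℕ) : Finset (Finset α) :=
  {C ∈ E.powerset | C.card ≤ s ∧ M.IsCircuit C}

open Classical in
/-- The chosen seeds, one for each hyperplane that is spanned by a seed. -/
noncomputable def seeds (M : Matroid α) (E : Finset α) (s : ℕ) : Finset (Finset α) :=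
  {X ∈ E.powerset | IsSeed M s X ∧ seedOf M s (M.closure X) = X}

open Classical in
/-- The one-element extensions of the chosen seeds, within the hyperplane that they span, that have
no short circuits. -/
noncomputable def seedExtensions (M : Matroid α) (E : Finset α) (s : ℕ) : Finset (Finset α) :=
  {Q ∈ E.powerset | NoShortCircuit M s Q ∧
    ∃ X ∈ seeds M E s, ∃ y ∈ M.closure X, y ∉ X ∧ Q = insert y X}

/-- The type of the values of `signature`. -/
abbrev SignatureData (α : Type*) : Type _ :=
  Finset (Finset α) × Finset (Finset α) × Finset (Finset α)

/-- The part of the matroid that is recorded at small cost: its short circuits, and the hyperplanes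
spanned by a seed, encoded by their chosen seed and its extensions. -/
noncomputable def signature (M : Matroid α) (E : Finset α) (s : ℕ) :
    SignatureData α :=
  (shortCircuits M E s, seeds M E s, seedExtensions M E s)

theorem isSeed_seedOf {M : Matroid α} {s : ℕ} {X : Finset α} (hX : IsSeed M s X) :
    IsSeed M s (seedOf M s (M.closure X)) ∧
      M.closure (seedOf M s (M.closure X)) = M.closure X := by
  have h : ∃ Y : Finset α, IsSeed M s Y ∧ M.closure Y = M.closure X := ⟨X, hX, rfl⟩
  unfold seedOf
  rw [dif_pos]
  exact h.choose_spec

theorem seedOf_mem_seeds {E : Finset α} {r : ℕ} {M : Matroid α} (hM : M ∈ MatroidsOn E r) {s : ℕ}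
    {X : Finset α} (hX : IsSeed M s X) : seedOf M s (M.closure X) ∈ seeds M E s := by
  have h := isSeed_seedOf hX
  simp only [seeds, Finset.mem_filter, Finset.mem_powerset]
  refine ⟨?_, h.1, by rw [h.2]⟩
  have := h.1.1
  rw [hM.1] at this
  exact_mod_cast this

theorem mem_shortCircuits {α : Type*} {E : Finset α} {r : ℕ} {M : Matroid α}
    (hM : M ∈ MatroidsOn E r) {s : ℕ} {C : Finset α} :
    C ∈ shortCircuits M E s ↔ C.card ≤ s ∧ M.IsCircuit C := by
  simp only [shortCircuits, Finset.mem_filter, Finset.mem_powerset, and_iff_right_iff_imp]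
  rintro ⟨-, hC⟩
  have := hC.subset_ground
  rw [hM.1] at this
  exact_mod_cast this

/-- If a hyperplane of `M` is spanned by a set `Q` of nullity two without short circuits, then no
matroid with the same signature has a basis inside that hyperplane. The reason is that the closure
of a seed in `M` is contained in its closure in `N`: each new element either gives a seed extension
or closes a short circuit, and both are recorded. -/
theorem not_isBase_of_subset_closure {E : Finset α} {r s : ℕ} {M N : Matroid α}
    (hM : M ∈ MatroidsOn E r) (hN : N ∈ MatroidsOn E r)
    (hMN : signature M E s = signature N E s) {Q X : Finset α} (hQE : Q ⊆ E)
    (hQ : Q.card = r + 1) (hQr : M.eRk Q + 1 = r) (hQs : NoShortCircuit M s Q)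
    (hXQ : (X : Set α) ⊆ M.closure Q) : ¬ N.IsBase X := by
  obtain ⟨hC, hS, hT⟩ : shortCircuits M E s = shortCircuits N E s ∧ seeds M E s = seeds N E s ∧
      seedExtensions M E s = seedExtensions N E s := by
    simpa [signature, Prod.ext_iff] using hMN
  have hQE' : (Q : Set α) ⊆ M.E := by rw [hM.1]; exact_mod_cast hQE
  -- Deleting a redundant element of `Q` gives a seed
  obtain ⟨u, huQ, hu⟩ : ∃ u ∈ Q, u ∈ M.closure ((Q : Set α) \ {u}) := by
    by_contra! h
    have hi : M.Indep Q := (Matroid.indep_iff_forall_notMem_closure_sdiff hQE').2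
      fun u hu => h u hu
    have := hi.eRk_eq_encard
    rw [Set.encard_coe_eq_coe_finsetCard, hQ] at this
    rw [this] at hQr
    norm_cast at hQr
    omega
  have hcl : M.closure ((Q.erase u : Finset α) : Set α) = M.closure Q := by
    rw [Finset.coe_erase]
    exact Matroid.closure_sdiff_singleton_eq_closure hu
  have hrk : M.eRk ((Q.erase u : Finset α) : Set α) = M.eRk Q := by
    rw [← M.eRk_closure_eq, hcl, M.eRk_closure_eq]
  have hseed : IsSeed M s (Q.erase u) := by
    refine ⟨(Finset.coe_subset.2 (Finset.erase_subset u Q)).trans hQE', ?_, ?_, u, ?_, by simp, ?_⟩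
    · rw [hrk, hQr, Finset.card_erase_of_mem huQ, hQ]; simp
    · rw [hrk, hQr, hM.2]
    · rw [hcl]; exact M.mem_closure_of_mem huQ hQE'
    · rwa [Finset.insert_erase huQ]
  have hX0 := isSeed_seedOf hseed
  have hmem := seedOf_mem_seeds hM hseed
  set X₀ := seedOf M s (M.closure ((Q.erase u : Finset α) : Set α)) with hX₀
  have hX0N : IsSeed N s X₀ := by
    have h := hmem
    rw [hS] at h
    simp only [seeds, Finset.mem_filter] at h
    exact h.2.1
  have hno : NoShortCircuit M s X₀ := by
    obtain ⟨-, -, -, y, -, -, hy⟩ := hX0.1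
    exact hy.mono (Finset.subset_insert _ _)
  have hsub : M.closure X₀ ⊆ N.closure X₀ := by
    intro y hy
    have hyE : y ∈ N.E := by
      rw [hN.1, ← hM.1]; exact M.closure_subset_ground _ hy
    by_cases hyX : y ∈ X₀
    · exact N.mem_closure_of_mem hyX hX0N.1
    by_cases hns : NoShortCircuit M s (insert y X₀)
    · have h : insert y X₀ ∈ seedExtensions M E s := by
        simp only [seedExtensions, Finset.mem_filter, Finset.mem_powerset]
        refine ⟨?_, hns, X₀, hmem, y, hy, hyX, rfl⟩
        have h1 := hX0.1.1
        rw [hM.1] at h1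
        rw [hN.1] at hyE
        exact Finset.insert_subset (by exact_mod_cast hyE) (by exact_mod_cast h1)
      rw [hT] at h
      simp only [seedExtensions, Finset.mem_filter, Finset.mem_powerset] at h
      obtain ⟨-, -, Y, hY, z, hz, hzY, hyz⟩ := h
      have hYs : IsSeed N s Y := by
        simp only [seeds, Finset.mem_filter] at hY
        exact hY.2.1
      have h2 : N.eRk ((insert y X₀ : Finset α) : Set α) = N.eRk X₀ := by
        rw [hyz, Finset.coe_insert, ← N.eRk_closure_eq,
          Matroid.closure_insert_eq_of_mem_closure hz, N.eRk_closure_eq]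
        have h3 := hYs.2.2.1
        rw [← hX0N.2.2.1] at h3
        exact ENat.add_left_injective_of_ne_top ENat.one_ne_top h3
      rw [Finset.coe_insert] at h2
      exact N.mem_closure_of_eRk_insert_le X₀.finite_toSet hyE h2.le
    · simp only [NoShortCircuit, not_forall, not_not] at hns
      obtain ⟨C, hCs, hCc, hCX⟩ := hns
      have hyC : y ∈ C := by
        by_contra h
        exact hno C hCs hCc ((Finset.subset_insert_iff_of_notMem h).1 hCX)
      have hCN : C ∈ shortCircuits N E s := hC ▸ (mem_shortCircuits hM).2 ⟨hCs, hCc⟩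
      exact ((mem_shortCircuits hN).1 hCN).2.mem_closure_of_subset_insert (by exact_mod_cast hyC)
        (by exact_mod_cast hCX)
  intro hb
  have h1 := N.eRk_mono ((hXQ.trans_eq (hcl.symm.trans hX0.2.symm)).trans hsub)
  rw [N.eRk_closure_eq, hb.eRk_eq_eRank, ← hX0N.2.2.1] at h1
  have : N.eRk X₀ ≠ ⊤ := ((N.eRk_le_encard _).trans_lt X₀.finite_toSet.encard_lt_top).ne
  lift N.eRk X₀ to ℕ using this with a
  norm_cast at h1
  omega

/-- An `r`-set `X` of rank at most `r - 2` without short circuits lies in a hyperplane that is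
spanned by a set of nullity two without short circuits: extend a basis `I` of `X` to a basis `J` of
a hyperplane, and add two elements of `X \ I`. All circuits of the resulting set lie in `X`. -/
theorem exists_nullity_two_of_eRk_lt {E : Finset α} {r s : ℕ} {M : Matroid α}
    (hM : M ∈ MatroidsOn E r) {X : Finset α} (hXE : X ⊆ E) (hX : X.card = r)
    (hrk : M.eRk X + 1 < r) (hs : NoShortCircuit M s X) :
    ∃ Q ⊆ E, Q.card = r + 1 ∧ M.eRk Q + 1 = r ∧ NoShortCircuit M s Q ∧
      (X : Set α) ⊆ M.closure Q := by
  have hXE' : (X : Set α) ⊆ M.E := by rw [hM.1]; exact_mod_cast hXE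
  obtain ⟨I', hI'⟩ := M.exists_isBasis X hXE'
  obtain ⟨I, rfl⟩ := MatroidsOn.exists_finset hM (hI'.indep.subset_ground)
  obtain ⟨B', hB', hIB'⟩ := hI'.indep.exists_isBase_superset
  obtain ⟨B, rfl⟩ := MatroidsOn.exists_finset hM hB'.subset_ground
  have hIX : I ⊆ X := by exact_mod_cast hI'.subset
  have hIB : I ⊆ B := by exact_mod_cast hIB'
  have hI2 : I.card + 1 < r := by
    rw [← hI'.encard_eq_eRk, Set.encard_coe_eq_coe_finsetCard] at hrk
    exact_mod_cast hrk
  have hBr : B.card = r := (Finset.mem_powersetCard.1 (MatroidsOn.isBase_card hM hB')).2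
  have hBE : B ⊆ E := (Finset.mem_powersetCard.1 (MatroidsOn.isBase_card hM hB')).1
  obtain ⟨Z, hIZ, hZX, hZ⟩ := Finset.exists_subsuperset_card_eq hIX (n := I.card + 2) (by omega)
    (by omega)
  obtain ⟨J, hIJ, hJB, hJ⟩ := Finset.exists_subsuperset_card_eq hIB (n := r - 1) (by omega)
    (by omega)
  have hJi : M.Indep J := hB'.indep.subset (by exact_mod_cast hJB)
  have hXJ : (X : Set α) ⊆ M.closure J :=
    hI'.subset_closure.trans (M.closure_subset_closure (by exact_mod_cast hIJ))
  have hZJ : (Z : Set α) ⊆ M.closure J := (Finset.coe_subset.2 hZX).trans hXJ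
  have hXJI : X ∩ J = I := by
    refine (Finset.subset_inter hIX hIJ).antisymm' fun x hx => ?_
    have hx' := Finset.mem_inter.1 hx
    by_contra hxI
    have h1 : x ∈ M.closure ((J : Set α) \ {x}) := by
      refine M.closure_subset_closure ?_ (hI'.subset_closure (by exact_mod_cast hx'.1))
      intro i hi
      exact ⟨by exact_mod_cast hIJ (by exact_mod_cast hi), by rintro rfl; exact hxI hi⟩
    exact hJi.notMem_closure_sdiff_of_mem (by exact_mod_cast hx'.2) h1
  have hcl : M.closure ((Z ∪ J : Finset α) : Set α) = M.closure J := by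
    refine subset_antisymm ?_ (M.closure_subset_closure (by simp))
    refine M.closure_subset_closure_of_subset_closure ?_
    rw [Finset.coe_union]
    exact Set.union_subset hZJ (M.subset_closure _ hJi.subset_ground)
  refine ⟨Z ∪ J, Finset.union_subset (hZX.trans hXE) (hJB.trans hBE), ?_, ?_, ?_, ?_⟩
  · have h1 := Finset.card_union_add_card_inter Z J
    have h2 : Z ∩ J = I := by
      refine subset_antisymm ?_ (Finset.subset_inter hIZ hIJ)
      rw [← hXJI]
      exact Finset.inter_subset_inter_right hZX
    rw [h2] at h1
    omega
  · rw [← M.eRk_closure_eq, hcl, M.eRk_closure_eq, hJi.eRk_eq_encard,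
      Set.encard_coe_eq_coe_finsetCard, hJ]
    norm_cast
    omega
  · intro C hCs hC hCQ
    refine hs C hCs hC fun c hc => ?_
    rcases Finset.mem_union.1 (hCQ hc) with h | h
    · exact hZX h
    by_contra hcX
    have h1 : c ∈ M.closure ((J : Set α) \ {c}) := by
      have h2 := hC.mem_closure_sdiff_singleton_of_mem (e := c) (by exact_mod_cast hc)
      refine M.closure_subset_closure_of_subset_closure ?_ h2
      rintro x ⟨hx, hxc⟩
      rcases Finset.mem_union.1 (hCQ (by exact_mod_cast hx)) with h3 | h3
      · refine M.closure_subset_closure ?_ (hI'.subset_closure (Finset.coe_subset.2 hZX h3))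
        intro i hi
        exact ⟨by exact_mod_cast hIJ (by exact_mod_cast hi),
          by rintro rfl; exact hcX (hIX (by exact_mod_cast hi))⟩
      · exact M.mem_closure_of_mem ⟨by exact_mod_cast h3, hxc⟩
          (Set.sdiff_subset.trans hJi.subset_ground)
    exact hJi.notMem_closure_sdiff_of_mem (by exact_mod_cast h) h1
  · rw [hcl]; exact hXJ

/-- An `r`-set that is a nonbasis of `M` but a basis of some matroid with the same signature has
rank `r - 1`, has no short circuit, and is joined to every further element of its closure by a short
circuit. -/
theorem nonbasis_of_isBase_of_signature_eq {E : Finset α} {r s : ℕ} {M N : Matroid α}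
    (hM : M ∈ MatroidsOn E r) (hN : N ∈ MatroidsOn E r)
    (hMN : signature M E s = signature N E s) {X : Finset α} (hXM : ¬ M.IsBase X)
    (hXN : N.IsBase X) :
    NoShortCircuit M s X ∧ M.eRk X + 1 = r ∧
      ∀ y ∈ M.closure X, y ∉ X →
        ∃ C : Finset α, C.card ≤ s ∧ M.IsCircuit C ∧ C ⊆ insert y X ∧ y ∈ C := by
  have hXE := (Finset.mem_powersetCard.1 (MatroidsOn.isBase_card hN hXN)).1
  have hXr := (Finset.mem_powersetCard.1 (MatroidsOn.isBase_card hN hXN)).2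
  have hXE' : (X : Set α) ⊆ M.E := by rw [hM.1]; exact_mod_cast hXE
  have hC : shortCircuits M E s = shortCircuits N E s := congrArg Prod.fst hMN
  have h1 : NoShortCircuit M s X := by
    intro C hCs hCc hCX
    have hCN := hC ▸ (mem_shortCircuits hM).2 ⟨hCs, hCc⟩
    exact ((mem_shortCircuits hN).1 hCN).2.not_indep
      (hXN.indep.subset (by exact_mod_cast hCX))
  have hne : M.eRk X ≠ ⊤ := ((M.eRk_le_encard _).trans_lt X.finite_toSet.encard_lt_top).ne
  have hlt : M.eRk X < r := by
    refine lt_of_le_of_ne (hM.2 ▸ M.eRk_le_eRank X) fun h => hXM ?_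
    have hi : M.Indep X := (Matroid.indep_iff_eRk_eq_encard_of_finite X.finite_toSet).2
      (by rw [h, Set.encard_coe_eq_coe_finsetCard, hXr])
    exact hi.isBase_of_eRk_ge X.finite_toSet (by rw [h, hM.2])
  have h2 : M.eRk X + 1 = r := by
    by_contra h
    have hlt' : M.eRk X + 1 < r := by
      refine lt_of_le_of_ne ?_ h
      exact Order.add_one_le_of_lt hlt
    obtain ⟨Q, hQE, hQ, hQr, hQs, hXQ⟩ := exists_nullity_two_of_eRk_lt hM hXE hXr hlt' h1
    exact not_isBase_of_subset_closure hM hN hMN hQE hQ hQr hQs hXQ hXN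
  refine ⟨h1, h2, fun y hy hyX => ?_⟩
  by_contra! h
  have hno : NoShortCircuit M s (insert y X) := by
    intro C hCs hCc hCX
    have hyC := h C hCs hCc hCX
    exact h1 C hCs hCc ((Finset.subset_insert_iff_of_notMem hyC).1 hCX)
  have hyE : y ∈ E := by
    have := M.closure_subset_ground _ hy
    rw [hM.1] at this
    exact_mod_cast this
  refine not_isBase_of_subset_closure hM hN hMN (Q := insert y X)
    (Finset.insert_subset hyE hXE) (by rw [Finset.card_insert_of_notMem hyX, hXr]) ?_ hno ?_ hXN
  · rw [Finset.coe_insert, ← M.eRk_closure_eq, Matroid.closure_insert_eq_of_mem_closure hy,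
      M.eRk_closure_eq, h2]
  · rw [Finset.coe_insert, Matroid.closure_insert_eq_of_mem_closure hy]
    exact M.subset_closure _ hXE'

end

/-! ### Ambiguous and linked sets -/

section

variable {α : Type*} [DecidableEq α]

/-- Exchanging two elements of a circuit `C ⊆ insert v X` does not affect whether a set is a
basis. -/
theorem isBase_iff_of_isCircuit {N : Matroid α} {C X : Finset α} {u v : α} (hC : N.IsCircuit C)
    (hCX : C ⊆ insert v X) (hu : u ∈ C) (hv : v ∈ C) (huX : u ∈ X) (hvX : v ∉ X) :
    N.IsBase X ↔ N.IsBase (insert v (X.erase u) : Finset α) := by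
  have key : ∀ {X : Finset α} {u v : α}, C ⊆ insert v X → u ∈ C → v ∈ C → u ∈ X → v ∉ X →
      N.IsBase X → N.IsBase (insert v (X.erase u) : Finset α) := by
    intro X u v hCX hu hv huX hvX hX
    have huv : u ≠ v := by rintro rfl; exact hvX huX
    have h := hX.isBase_insert_sdiff_of_mem_closure (e := u) (f := v) ?_ (by simp [huX])
    · convert h using 1
      ext x
      simp only [Finset.coe_insert, Finset.coe_erase, Set.mem_insert_iff, Set.mem_sdiff,
        Set.mem_singleton_iff]
      by_cases hx : x = v
      · subst hx; simp [huv.symm]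
      · simp [hx]
    · refine N.closure_subset_closure ?_ (hC.mem_closure_sdiff_singleton_of_mem hu)
      exact Set.sdiff_subset_sdiff_left (by exact_mod_cast hCX)
  refine ⟨key hCX hu hv huX hvX, fun h => ?_⟩
  have huv : u ≠ v := by rintro rfl; exact hvX huX
  have h2 := key (X := insert v (X.erase u)) (u := v) (v := u) ?_ hv hu (by simp) (by simp [huv]) h
  · convert h2 using 2
    ext x
    simp only [Finset.mem_insert, Finset.mem_erase]
    grind
  · intro x hx
    have := hCX hx
    simp only [Finset.mem_insert, Finset.mem_erase] at this ⊢
    tauto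

/-- The signatures of a matroid and of its dual; together they record the short circuits and the
short cocircuits. -/
noncomputable def fullSignature (M : Matroid α) (E : Finset α) (s : ℕ) :
    SignatureData α × SignatureData α :=
  (signature M E s, signature M✶ E s)

/-- Two sets are linked with respect to a signature `σ` if they have the same status (basis or
not) in every matroid with that signature. -/
def Linked (E : Finset α) (r s : ℕ) (σ : SignatureData α × SignatureData α) (X Y : Finset α) :
    Prop :=
  ∀ N ∈ MatroidsOn E r, fullSignature N E s = σ → (N.IsBase X ↔ N.IsBase Y)

open Classical in
/-- The `r`-sets that are nonbases of `M`, but not on account of the signature alone. -/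
noncomputable def ambiguous (E : Finset α) (r s : ℕ) (M : Matroid α) : Finset (Finset α) :=
  {X ∈ E.powersetCard r | ¬ M.IsBase X ∧
    ∃ N ∈ MatroidsOn E r, fullSignature N E s = fullSignature M E s ∧ N.IsBase X}

variable {E : Finset α} {r s : ℕ} {M N : Matroid α}

theorem mem_ambiguous {X : Finset α} : X ∈ ambiguous E r s M ↔ ¬ M.IsBase X ∧
    ∃ N ∈ MatroidsOn E r, fullSignature N E s = fullSignature M E s ∧ N.IsBase X := by
  simp only [ambiguous, Finset.mem_filter, and_iff_right_iff_imp]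
  rintro ⟨-, N, hN, -, h⟩
  exact MatroidsOn.isBase_card hN h

theorem subset_of_mem_ambiguous {X : Finset α} (hX : X ∈ ambiguous E r s M) : X ⊆ E := by
  simp only [ambiguous, Finset.mem_filter, Finset.mem_powersetCard] at hX
  exact hX.1.1

theorem card_of_mem_ambiguous {X : Finset α} (hX : X ∈ ambiguous E r s M) : X.card = r := by
  simp only [ambiguous, Finset.mem_filter, Finset.mem_powersetCard] at hX
  exact hX.1.2

theorem Linked.symm {σ} {X Y : Finset α} (h : Linked E r s σ X Y) : Linked E r s σ Y X :=
  fun N hN hσ => (h N hN hσ).symm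

theorem Linked.trans {σ} {X Y Z : Finset α} (h : Linked E r s σ X Y) (h' : Linked E r s σ Y Z) :
    Linked E r s σ X Z :=
  fun N hN hσ => (h N hN hσ).trans (h' N hN hσ)

theorem Linked.mem_ambiguous {X Y : Finset α} (hM : M ∈ MatroidsOn E r)
    (h : Linked E r s (fullSignature M E s) X Y) (hX : X ∈ ambiguous E r s M) :
    Y ∈ ambiguous E r s M := by
  rw [MatroidAsymptotics.mem_ambiguous] at hX ⊢
  obtain ⟨h1, N, hN, hσ, h2⟩ := hX
  exact ⟨fun h3 => h1 ((h M hM rfl).2 h3), N, hN, hσ, (h N hN hσ).1 h2⟩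

theorem spec_of_mem_ambiguous (hM : M ∈ MatroidsOn E r) {X : Finset α}
    (hX : X ∈ ambiguous E r s M) :
    NoShortCircuit M s X ∧ M.eRk X + 1 = r ∧
      ∀ y ∈ M.closure X, y ∉ X →
        ∃ C : Finset α, C.card ≤ s ∧ M.IsCircuit C ∧ C ⊆ insert y X ∧ y ∈ C := by
  obtain ⟨h, N, hN, hσ, hb⟩ := mem_ambiguous.1 hX
  exact nonbasis_of_isBase_of_signature_eq hM hN (congrArg Prod.fst hσ).symm h hb

/-- Complementation turns ambiguous sets of a matroid into ambiguous sets of its dual. -/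
theorem mem_ambiguous_dual (hM : M ∈ MatroidsOn E r) {X : Finset α}
    (hX : X ∈ ambiguous E r s M) : E \ X ∈ ambiguous E (E.card - r) s M✶ := by
  have hXE := subset_of_mem_ambiguous hX
  rw [mem_ambiguous] at hX ⊢
  obtain ⟨h, N, hN, hσ, hb⟩ := hX
  rw [MatroidsOn.isBase_iff_compl hM hXE]
  refine ⟨h, N✶, MatroidsOn.dual hN, ?_, (MatroidsOn.isBase_iff_compl hN hXE).2 hb⟩
  simp only [fullSignature, Prod.mk.injEq, Matroid.dual_dual] at hσ ⊢
  exact ⟨hσ.2, hσ.1⟩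

theorem isBase_iff_of_mem_closure (hM : M ∈ MatroidsOn E r) {X : Finset α} {u v : α}
    (hX : X ∈ ambiguous E r s M) (hv : v ∈ M.closure X) (hvX : v ∉ X) (hu : u ∈ X)
    (hno : NoShortCircuit M s (insert v (X.erase u))) (hN : N ∈ MatroidsOn E r)
    (hσ : signature N E s = signature M E s) :
    N.IsBase X ↔ N.IsBase (insert v (X.erase u) : Finset α) := by
  obtain ⟨C, hCs, hC, hCX, hvC⟩ := (spec_of_mem_ambiguous hM hX).2.2 v hv hvX
  have huC : u ∈ C := by
    by_contra h
    refine hno C hCs hC fun x hx => ?_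
    have := hCX hx
    simp only [Finset.mem_insert, Finset.mem_erase] at this ⊢
    rcases this with h' | h'
    · exact Or.inl h'
    · exact Or.inr ⟨by rintro rfl; exact h hx, h'⟩
  have hCN : C ∈ shortCircuits N E s := by
    rw [show shortCircuits N E s = shortCircuits M E s from congrArg Prod.fst hσ]
    exact (mem_shortCircuits hM).2 ⟨hCs, hC⟩
  exact isBase_iff_of_isCircuit ((mem_shortCircuits hN).1 hCN).2 hCX huC hvC hu hvX

theorem sdiff_insert_erase {X : Finset α} {u v : α} (hXE : X ⊆ E) (hu : u ∈ X) (hv : v ∈ E)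
    (hvX : v ∉ X) : E \ insert v (X.erase u) = insert u ((E \ X).erase v) := by
  ext x
  simp only [Finset.mem_sdiff, Finset.mem_insert, Finset.mem_erase]
  by_cases hx : x = u
  · subst hx
    simp [hXE hu, show x ≠ v by rintro rfl; exact hvX hu]
  · simp only [hx, false_or]
    tauto

/-- Adjacent ambiguous sets differ by an exchange along a short circuit or a short cocircuit, hence
are linked. -/
theorem JohnsonAdj.linked (hM : M ∈ MatroidsOn E r) {X Y : Finset α}
    (hX : X ∈ ambiguous E r s M) (hY : Y ∈ ambiguous E r s M) (h : JohnsonAdj X Y) :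
    Linked E r s (fullSignature M E s) X Y := by
  have := MatroidsOn.finite hM
  obtain ⟨u, hu, v, hvX, rfl⟩ := h
  intro N hN hσ
  simp only [fullSignature, Prod.mk.injEq] at hσ
  have hXE := subset_of_mem_ambiguous hX
  have hvE : v ∈ E := subset_of_mem_ambiguous hY (by simp)
  have hXE' : (X : Set α) ⊆ M.E := by rw [hM.1]; exact_mod_cast hXE
  by_cases hv : v ∈ M.closure X
  · exact isBase_iff_of_mem_closure hM hX hv hvX hu (spec_of_mem_ambiguous hM hY).1 hN hσ.1
  rcases M.mem_closure_or_mem_dual_closure hXE' (u := u) (by exact_mod_cast hu) with h | h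
  · -- In this case `insert v (X.erase u)` would have full rank
    exfalso
    apply (mem_ambiguous.1 hY).1
    have hcl := Matroid.closure_sdiff_singleton_eq_closure h
    have hv' : v ∉ M.closure ((X : Set α) \ {u}) := by rwa [hcl]
    have h1 := M.eRk_insert_eq_add_one (e := v) (X := (X : Set α) \ {u})
      ⟨by rw [hM.1]; exact_mod_cast hvE, hv'⟩
    rw [← M.eRk_closure_eq (_ \ _), hcl, M.eRk_closure_eq, (spec_of_mem_ambiguous hM hX).2.1] at h1
    have h2 : M.eRk (insert v (X.erase u) : Finset α) = r := by
      rw [Finset.coe_insert, Finset.coe_erase, h1]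
    refine Matroid.Indep.isBase_of_eRk_ge ?_ (Finset.finite_toSet _) (by rw [h2, hM.2])
    rw [Matroid.indep_iff_eRk_eq_encard_of_finite (Finset.finite_toSet _), h2,
      Set.encard_coe_eq_coe_finsetCard, card_of_mem_ambiguous hY]
  · have hX' := mem_ambiguous_dual hM hX
    have hY' := mem_ambiguous_dual hM hY
    have hYE := subset_of_mem_ambiguous hY
    rw [← MatroidsOn.isBase_iff_compl hN hXE, ← MatroidsOn.isBase_iff_compl hN hYE]
    rw [sdiff_insert_erase hXE hu hvE hvX] at hY' ⊢
    rw [hM.1, ← Finset.coe_sdiff] at h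
    exact isBase_iff_of_mem_closure (MatroidsOn.dual hM) hX' h (by simp [hu])
      (by simp [hvE, hvX]) (spec_of_mem_ambiguous (MatroidsOn.dual hM) hY').1
      (MatroidsOn.dual hN) hσ.2

/-- In a matroid without loops, an ambiguous set that is not closed has an exchange along a short
circuit, which does not change its status in any matroid with the same signature. -/
theorem exists_exchange_of_mem_closure (hM : M ∈ MatroidsOn E r) (hl : ∀ e, ¬ M.IsLoop e)
    {X : Finset α} {v : α} (hX : X ∈ ambiguous E r s M) (hv : v ∈ M.closure X) (hvX : v ∉ X) :
    ∃ u ∈ X, ∀ N ∈ MatroidsOn E r, signature N E s = signature M E s →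
      (N.IsBase X ↔ N.IsBase (insert v (X.erase u) : Finset α)) := by
  obtain ⟨C, hCs, hC, hCX, hvC⟩ := (spec_of_mem_ambiguous hM hX).2.2 v hv hvX
  obtain ⟨u, huC, huv⟩ : ∃ u ∈ C, u ≠ v := by
    by_contra! h
    have : C = {v} := by
      ext x
      simp only [Finset.mem_singleton]
      exact ⟨h x, by rintro rfl; exact hvC⟩
    apply hl v
    rw [this, Finset.coe_singleton] at hC
    exact Matroid.singleton_isCircuit.1 hC
  have huX : u ∈ X := (Finset.mem_insert.1 (hCX huC)).resolve_left huv
  refine ⟨u, huX, fun N hN hσ => ?_⟩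
  have hCN : C ∈ shortCircuits N E s := by
    rw [show shortCircuits N E s = shortCircuits M E s from congrArg Prod.fst hσ]
    exact (mem_shortCircuits hM).2 ⟨hCs, hC⟩
  exact isBase_iff_of_isCircuit ((mem_shortCircuits hN).1 hCN).2 hCX huC hvC huX hvX

/-- In a matroid without loops and coloops, an ambiguous set that is not a circuit-hyperplane is
linked to another set. -/
theorem exists_linked_ne (hM : M ∈ MatroidsOn E r) (hl : ∀ e, ¬ M.IsLoop e)
    (hcl : ∀ e, ¬ M.IsColoop e) {X : Finset α} (hX : X ∈ ambiguous E r s M)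
    (hW : ¬ (M.IsCircuit X ∧ M.IsFlat X ∧ M.eRk X + 1 = M.eRank)) :
    ∃ Y, Y ≠ X ∧ Linked E r s (fullSignature M E s) X Y := by
  have := MatroidsOn.finite hM
  have hXE := subset_of_mem_ambiguous hX
  have hXE' : (X : Set α) ⊆ M.E := by rw [hM.1]; exact_mod_cast hXE
  have hrk := (spec_of_mem_ambiguous hM hX).2.1
  by_cases hv : ∃ v ∈ M.closure X, v ∉ X
  · obtain ⟨v, hv, hvX⟩ := hv
    obtain ⟨u, hu, h⟩ := exists_exchange_of_mem_closure hM hl hX hv hvX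
    refine ⟨_, ?_, fun N hN hσ => h N hN (congrArg Prod.fst hσ)⟩
    exact (JohnsonAdj.ne ⟨u, hu, v, hvX, rfl⟩).symm
  push Not at hv
  have hflat : M.IsFlat X := Matroid.isFlat_iff_closure_eq.2
    (subset_antisymm (fun x hx => by exact_mod_cast hv x hx) (M.subset_closure _ hXE'))
  have hnc : ¬ M.IsCircuit X := fun h => hW ⟨h, hflat, by rw [hrk, hM.2]⟩
  have hdep : M.Dep X := by
    refine (Matroid.not_indep_iff hXE').1 fun h => ?_
    have := h.eRk_eq_encard
    rw [Set.encard_coe_eq_coe_finsetCard, card_of_mem_ambiguous hX] at this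
    rw [this] at hrk
    norm_cast at hrk
    omega
  obtain ⟨x, hx, hxi⟩ : ∃ x ∈ X, ¬ M.Indep ((X : Set α) \ {x}) := by
    by_contra! h
    exact hnc (Matroid.isCircuit_iff_dep_forall_sdiff_singleton_indep.2
      ⟨hdep, fun e he => h e (by exact_mod_cast he)⟩)
  -- As `X \ {x}` is dependent, `x` is a coloop of the restriction to `X`
  have hxcl : x ∉ M.closure ((X : Set α) \ {x}) := by
    intro h
    apply hxi
    rw [Matroid.indep_iff_eRk_eq_encard_of_finite (X.finite_toSet.subset Set.sdiff_subset),
      ← M.eRk_closure_eq, Matroid.closure_sdiff_singleton_eq_closure h, M.eRk_closure_eq,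
      ← Finset.coe_erase, Set.encard_coe_eq_coe_finsetCard, Finset.card_erase_of_mem hx,
      card_of_mem_ambiguous hX]
    have hpos : 1 ≤ r := by
      rw [← card_of_mem_ambiguous hX]; exact Finset.card_pos.2 ⟨x, hx⟩
    have hne : M.eRk X ≠ ⊤ := ((M.eRk_le_encard _).trans_lt X.finite_toSet.encard_lt_top).ne
    lift M.eRk X to ℕ using hne with a
    norm_cast at hrk ⊢
    omega
  have hxd := (M.mem_closure_or_mem_dual_closure hXE' (u := x)
    (by exact_mod_cast hx)).resolve_left hxcl
  rw [hM.1, ← Finset.coe_sdiff] at hxd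
  obtain ⟨u, hu, h⟩ := exists_exchange_of_mem_closure (MatroidsOn.dual hM)
    (fun e he => hcl e he) (mem_ambiguous_dual hM hX) hxd (by simp [hx])
  have hu' := Finset.mem_sdiff.1 hu
  refine ⟨insert u (X.erase x), (JohnsonAdj.ne ⟨x, hx, u, hu'.2, rfl⟩).symm, fun N hN hσ => ?_⟩
  rw [← MatroidsOn.isBase_iff_compl hN hXE, ← MatroidsOn.isBase_iff_compl hN
    (Finset.insert_subset hu'.1 ((Finset.erase_subset _ _).trans hXE)),
    sdiff_insert_erase hXE hx hu'.1 hu'.2]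
  exact h N✶ (MatroidsOn.dual hN) (congrArg Prod.snd hσ)

end

/-! ### Encoding by stable sets and by circuit-hyperplanes -/

/-- The subsets of `P` with at most `q` elements. -/
def boundedSubsets {β : Type*} (P : Finset β) (q : ℕ) : Finset (Finset β) :=
  {F ∈ P.powerset | F.card ≤ q}

theorem mem_boundedSubsets {β : Type*} {P F : Finset β} {q : ℕ} :
    F ∈ boundedSubsets P q ↔ F ⊆ P ∧ F.card ≤ q := by
  simp [boundedSubsets]

/-- A set of at most `q` elements has weight at least `1` if each element contributes a factor `1 /
y` to the weight `y ^ q` of the empty set. -/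
theorem card_boundedSubsets_le {β : Type*} (P : Finset β) (q : ℕ) {y : ℝ} (hy : 1 ≤ y) :
    ((boundedSubsets P q).card : ℝ) ≤ y ^ q * (1 + 1 / y) ^ P.card := by
  classical
  have hy0 : 0 < y := by linarith
  calc ((boundedSubsets P q).card : ℝ) = ∑ F ∈ boundedSubsets P q, (1 : ℝ) := by simp
    _ ≤ ∑ F ∈ boundedSubsets P q, y ^ q * (1 / y) ^ F.card := by
        refine Finset.sum_le_sum fun F hF => ?_
        have h : F.card ≤ q := (mem_boundedSubsets.1 hF).2
        rw [one_div, inv_pow, ← div_eq_mul_inv, one_le_div (by positivity)]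
        exact pow_le_pow_right₀ hy h
    _ ≤ ∑ F ∈ P.powerset, y ^ q * (1 / y) ^ F.card := by
        refine Finset.sum_le_sum_of_subset_of_nonneg (Finset.filter_subset _ _) ?_
        intros; positivity
    _ = y ^ q * (1 + 1 / y) ^ P.card := by
        rw [← Finset.mul_sum, add_comm, Finset.sum_pow_mul_eq_add_pow (1 / y) 1 P |>.symm]
        simp

section
variable {α : Type*} [DecidableEq α] {E : Finset α} {r s : ℕ} {M N : Matroid α}
  {σ : SignatureData α × SignatureData α} {X Y : Finset α}

/-- The equivalence relation of being linked. -/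
def linkSetoid (E : Finset α) (r s : ℕ) (σ : SignatureData α × SignatureData α) :
    Setoid (Finset α) where
  r := Linked E r s σ
  iseqv := ⟨fun _ _ _ _ => Iff.rfl, fun h => h.symm, fun h h' => h.trans h'⟩

/-- A chosen member of the link class of `X`; it depends only on the class and on `σ`. -/
noncomputable def linkRep (E : Finset α) (r s : ℕ) (σ : SignatureData α × SignatureData α)
    (X : Finset α) : Finset α :=
  (Quotient.mk (linkSetoid E r s σ) X).out

theorem linked_linkRep : Linked E r s σ X (linkRep E r s σ X) :=
  Linked.symm (Quotient.mk_out (s := linkSetoid E r s σ) X)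

theorem linkRep_eq_of_linked (h : Linked E r s σ X Y) :
    linkRep E r s σ X = linkRep E r s σ Y := by
  unfold linkRep
  rw [Quotient.sound (s := linkSetoid E r s σ) h]

theorem linkRep_linkRep : linkRep E r s σ (linkRep E r s σ X) = linkRep E r s σ X :=
  (linkRep_eq_of_linked linked_linkRep).symm

open Classical in
/-- A member of the link class of `X` different from `X`, if there is one. -/
noncomputable def linkPartner (E : Finset α) (r s : ℕ) (σ : SignatureData α × SignatureData α)
    (X : Finset α) : Finset α :=
  if h : ∃ Y, Y ≠ X ∧ Linked E r s σ X Y then h.choose else X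

theorem linked_linkPartner : Linked E r s σ X (linkPartner E r s σ X) := by
  unfold linkPartner
  split_ifs with h
  · exact h.choose_spec.2
  · exact fun _ _ _ => Iff.rfl

/-- The chosen representatives of the link classes of ambiguous sets. -/
noncomputable def representatives (E : Finset α) (r s : ℕ) (M : Matroid α) : Finset (Finset α) :=
  {X ∈ ambiguous E r s M | linkRep E r s (fullSignature M E s) X = X}

open Classical in
/-- The representatives of the link classes that are not singletons. -/
noncomputable def freeRepresentatives (E : Finset α) (r s : ℕ) (M : Matroid α) :
    Finset (Finset α) :=
  {X ∈ representatives E r s M | ∃ Y, Y ≠ X ∧ Linked E r s (fullSignature M E s) X Y}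

theorem mem_freeRepresentatives : X ∈ freeRepresentatives E r s M ↔ X ∈ representatives E r s M ∧
    ∃ Y, Y ≠ X ∧ Linked E r s (fullSignature M E s) X Y := by
  simp only [freeRepresentatives, Finset.mem_filter]

theorem linkPartner_ne (h : X ∈ freeRepresentatives E r s M) :
    linkPartner E r s (fullSignature M E s) X ≠ X := by
  have h' := (mem_freeRepresentatives.1 h).2
  unfold linkPartner
  rw [dif_pos h']
  exact h'.choose_spec.1

theorem eq_of_linked_of_mem_representatives (hX : X ∈ representatives E r s M)
    (hY : Y ∈ representatives E r s M) (h : Linked E r s (fullSignature M E s) X Y) : X = Y := by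
  rw [← (Finset.mem_filter.1 hX).2, ← (Finset.mem_filter.1 hY).2, linkRep_eq_of_linked h]

theorem linkRep_mem_representatives (hM : M ∈ MatroidsOn E r) (hX : X ∈ ambiguous E r s M) :
    linkRep E r s (fullSignature M E s) X ∈ representatives E r s M :=
  Finset.mem_filter.2 ⟨linked_linkRep.mem_ambiguous hM hX, linkRep_linkRep⟩

/-- The representatives, where those in `S` are exchanged for another member of their class. -/
noncomputable def switched (E : Finset α) (r s : ℕ) (M : Matroid α) (S : Finset (Finset α)) :
    Finset (Finset α) :=
  (representatives E r s M \ S) ∪ S.image (linkPartner E r s (fullSignature M E s))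

/-- A family of sets no two of which are adjacent in the Johnson graph. -/
def IsStable (𝒮 : Finset (Finset α)) : Prop :=
  ∀ X ∈ 𝒮, ∀ Y ∈ 𝒮, ¬ JohnsonAdj X Y

open Classical in
/-- The stable sets of the Johnson graph on the `r`-subsets of `E`. -/
noncomputable def stableFamilies (E : Finset α) (r : ℕ) : Finset (Finset (Finset α)) :=
  {𝒮 ∈ (E.powersetCard r).powerset | IsStable 𝒮}

/-- Each member of `switched E r s M S` is linked to a representative, which lies in `S` or not
according to how the member was obtained. -/
theorem exists_of_mem_switched {S : Finset (Finset α)} (hS : S ⊆ freeRepresentatives E r s M)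
    (hX : X ∈ switched E r s M S) : ∃ V ∈ representatives E r s M,
      Linked E r s (fullSignature M E s) V X ∧
        X = if V ∈ S then linkPartner E r s (fullSignature M E s) V else V := by
  rcases Finset.mem_union.1 hX with h | h
  · have h' := Finset.mem_sdiff.1 h
    exact ⟨X, h'.1, fun _ _ _ => Iff.rfl, by rw [if_neg h'.2]⟩
  · obtain ⟨V, hV, rfl⟩ := Finset.mem_image.1 h
    exact ⟨V, (mem_freeRepresentatives.1 (hS hV)).1, linked_linkPartner, by rw [if_pos hV]⟩

theorem switched_subset_ambiguous (hM : M ∈ MatroidsOn E r) {S : Finset (Finset α)}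
    (hS : S ⊆ freeRepresentatives E r s M) : switched E r s M S ⊆ ambiguous E r s M := by
  intro X hX
  obtain ⟨V, hV, h, -⟩ := exists_of_mem_switched hS hX
  exact h.mem_ambiguous hM (Finset.mem_filter.1 hV).1

theorem switched_mem_stableFamilies (hM : M ∈ MatroidsOn E r) {S : Finset (Finset α)}
    (hS : S ⊆ freeRepresentatives E r s M) : switched E r s M S ∈ stableFamilies E r := by
  have hsub := switched_subset_ambiguous hM hS
  simp only [stableFamilies, Finset.mem_filter]
  refine ⟨Finset.mem_powerset.2 fun X hX => ?_, fun X hX Y hY h => ?_⟩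
  · exact Finset.mem_powersetCard.2 ⟨subset_of_mem_ambiguous (hsub hX),
      card_of_mem_ambiguous (hsub hX)⟩
  · have hl := h.linked hM (hsub hX) (hsub hY)
    obtain ⟨V, hV, hVX, hX'⟩ := exists_of_mem_switched hS hX
    obtain ⟨W, hW, hWY, hY'⟩ := exists_of_mem_switched hS hY
    have : V = W := eq_of_linked_of_mem_representatives hV hW ((hVX.trans hl).trans hWY.symm)
    subst this
    exact h.ne (hX'.trans hY'.symm)

theorem exists_mem_switched {S : Finset (Finset α)} {V : Finset α}
    (hV : V ∈ representatives E r s M) :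
    ∃ X ∈ switched E r s M S, Linked E r s (fullSignature M E s) V X := by
  by_cases h : V ∈ S
  · exact ⟨_, Finset.mem_union_right _ (Finset.mem_image_of_mem _ h), linked_linkPartner⟩
  · exact ⟨V, Finset.mem_union_left _ (Finset.mem_sdiff.2 ⟨hV, h⟩), fun _ _ _ => Iff.rfl⟩

/-- If `M` and `N` have the same signature and each link class of ambiguous sets of `M` contains a
nonbasis of `N`, then all bases of `N` are bases of `M`. -/
theorem isBase_of_isBase_of_forall_linked (hM : M ∈ MatroidsOn E r) (hN : N ∈ MatroidsOn E r)
    (hσ : fullSignature M E s = fullSignature N E s)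
    (h : ∀ V ∈ representatives E r s M, ∃ Y, Linked E r s (fullSignature M E s) V Y ∧
      ¬ N.IsBase Y) (hX : N.IsBase X) : M.IsBase X := by
  by_contra hXM
  have hXa : X ∈ ambiguous E r s M := mem_ambiguous.2 ⟨hXM, N, hN, hσ.symm, hX⟩
  obtain ⟨Y, hY, hYN⟩ := h _ (linkRep_mem_representatives hM hXa)
  exact hYN (((linked_linkRep.trans hY) N hN hσ.symm).1 hX)

theorem eq_of_switched_eq (hM : M ∈ MatroidsOn E r) (hN : N ∈ MatroidsOn E r)
    (hσ : fullSignature M E s = fullSignature N E s) {S T : Finset (Finset α)}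
    (hS : S ⊆ freeRepresentatives E r s M) (hT : T ⊆ freeRepresentatives E r s N)
    (h : switched E r s M S = switched E r s N T) : M = N := by
  have key : ∀ {M N : Matroid α} {S T : Finset (Finset α)}, M ∈ MatroidsOn E r →
      N ∈ MatroidsOn E r → fullSignature M E s = fullSignature N E s →
      T ⊆ freeRepresentatives E r s N →
      switched E r s M S = switched E r s N T → ∀ X : Finset α, N.IsBase X → M.IsBase X := by
    intro M N S T hM hN hσ hT h X hX
    refine isBase_of_isBase_of_forall_linked hM hN hσ (fun V hV => ?_) hX
    obtain ⟨Y, hY, hVY⟩ := exists_mem_switched (S := S) hV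
    rw [h] at hY
    exact ⟨Y, hVY, (mem_ambiguous.1 (switched_subset_ambiguous hN hT hY)).1⟩
  exact MatroidsOn.ext hM hN fun X => ⟨key hN hM hσ.symm hS h.symm X, key hM hN hσ hT h X⟩

/-- The family `S` can be recovered from `switched E r s M S`. -/
theorem mem_iff_notMem_switched {S : Finset (Finset α)} (hS : S ⊆ freeRepresentatives E r s M)
    {V : Finset α} : V ∈ S ↔ V ∈ representatives E r s M ∧ V ∉ switched E r s M S := by
  refine ⟨fun hV => ⟨(mem_freeRepresentatives.1 (hS hV)).1, fun h => ?_⟩, fun h => ?_⟩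
  · obtain ⟨W, hW, hWV, hV'⟩ := exists_of_mem_switched hS h
    have : W = V :=
      eq_of_linked_of_mem_representatives hW (mem_freeRepresentatives.1 (hS hV)).1 hWV
    subst this
    rw [if_pos hV] at hV'
    exact linkPartner_ne (hS hV) hV'.symm
  · by_contra hV
    exact h.2 (Finset.mem_union_left _ (Finset.mem_sdiff.2 ⟨h.1, hV⟩))

/-- Each matroid with `t` link classes that are not singletons gives rise to `2 ^ t` stable sets,
any of which determines the matroid, given the signature. -/
theorem card_mul_two_pow_le {K : Finset (Matroid α)} (hK : ∀ M ∈ K, M ∈ MatroidsOn E r) {t : ℕ}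
    (ht : ∀ M ∈ K, t ≤ (freeRepresentatives E r s M).card)
    {𝒯 : Finset (SignatureData α × SignatureData α)}
    (h𝒯 : ∀ M ∈ K, fullSignature M E s ∈ 𝒯) :
    K.card * 2 ^ t ≤ 𝒯.card * (stableFamilies E r).card := by
  classical
  calc K.card * 2 ^ t ≤ ∑ M ∈ K, (freeRepresentatives E r s M).powerset.card := by
        rw [← smul_eq_mul]
        refine Finset.card_nsmul_le_sum _ _ _ fun M hM => ?_
        rw [Finset.card_powerset]
        exact Nat.pow_le_pow_right (by norm_num) (ht M hM)
    _ = (K.sigma fun M => (freeRepresentatives E r s M).powerset).card :=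
        (Finset.card_sigma _ _).symm
    _ ≤ (𝒯 ×ˢ stableFamilies E r).card := by
        refine Finset.card_le_card_of_injOn
          (fun p => (fullSignature p.1 E s, switched E r s p.1 p.2)) ?_ ?_
        · rintro ⟨M, S⟩ h
          simp only [Finset.coe_sigma, Set.mem_sigma_iff, Finset.mem_coe,
            Finset.mem_powerset] at h
          exact Finset.mem_coe.2 (Finset.mem_product.2
            ⟨h𝒯 M h.1, switched_mem_stableFamilies (hK M h.1) h.2⟩)
        · rintro ⟨M, S⟩ h ⟨N, T⟩ h' heq
          simp only [Finset.coe_sigma, Set.mem_sigma_iff, Finset.mem_coe,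
            Finset.mem_powerset] at h h'
          simp only [Prod.mk.injEq] at heq
          have : M = N := eq_of_switched_eq (hK M h.1) (hK N h'.1) heq.1 h.2 h'.2 heq.2
          subst this
          have : S = T := by
            ext V
            rw [mem_iff_notMem_switched h.2, mem_iff_notMem_switched h'.2, heq.2]
          rw [this]
    _ = 𝒯.card * (stableFamilies E r).card := Finset.card_product _ _

end

/-- A matroid without loops and coloops is determined by its signature, its circuit-hyperplanes and
the representatives of its link classes that are not singletons. -/
theorem eq_of_circuitHyperplanes_eq {E : Finset ℕ} {r s : ℕ} {M N : Matroid ℕ}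
    (hM : M ∈ MatroidsOn E r) (hN : N ∈ MatroidsOn E r)
    (hMl : ∀ e, ¬ M.IsLoop e) (hMc : ∀ e, ¬ M.IsColoop e)
    (hNl : ∀ e, ¬ N.IsLoop e) (hNc : ∀ e, ¬ N.IsColoop e)
    (hσ : fullSignature M E s = fullSignature N E s)
    (hW : circuitHyperplanes M = circuitHyperplanes N)
    (hT : freeRepresentatives E r s M = freeRepresentatives E r s N) : M = N := by
  have key : ∀ {M N : Matroid ℕ}, M ∈ MatroidsOn E r → N ∈ MatroidsOn E r →
      (∀ e, ¬ M.IsLoop e) → (∀ e, ¬ M.IsColoop e) → fullSignature M E s = fullSignature N E s →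
      circuitHyperplanes M = circuitHyperplanes N →
      freeRepresentatives E r s M = freeRepresentatives E r s N →
      ∀ X : Finset ℕ, N.IsBase X → M.IsBase X := by
    intro M N hM hN hl hc hσ hW hT X hX
    refine isBase_of_isBase_of_forall_linked hM hN hσ
      (fun V hV => ⟨V, fun _ _ _ => Iff.rfl, ?_⟩) hX
    by_cases hVT : V ∈ freeRepresentatives E r s M
    · rw [hT] at hVT
      exact (mem_ambiguous.1 (Finset.mem_filter.1 (mem_freeRepresentatives.1 hVT).1).1).1
    · have hVW : (V : Set ℕ) ∈ circuitHyperplanes M := by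
        by_contra h
        exact hVT (mem_freeRepresentatives.2 ⟨hV, exists_linked_ne hM hl hc
          (Finset.mem_filter.1 hV).1 h⟩)
      rw [hW] at hVW
      exact fun hb => hVW.1.not_indep hb.indep
  exact MatroidsOn.ext hM hN fun X =>
    ⟨key hN hM hNl hNc hσ.symm hW.symm hT.symm X, key hM hN hMl hMc hσ hW hT X⟩

open Classical in
/-- The number of matroids without loops and coloops that have few link classes with more than one
member is bounded by the number of their families of circuit-hyperplanes, up to a small factor. -/
theorem card_le_mul_card_image_circuitHyperplanes {E : Finset ℕ} {r s t : ℕ}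
    {K : Finset (Matroid ℕ)} (hK : ∀ M ∈ K, M ∈ MatroidsOn E r)
    (hl : ∀ M ∈ K, ∀ e, ¬ M.IsLoop e) (hc : ∀ M ∈ K, ∀ e, ¬ M.IsColoop e)
    (ht : ∀ M ∈ K, (freeRepresentatives E r s M).card ≤ t)
    {𝒯 : Finset (SignatureData ℕ × SignatureData ℕ)}
    (h𝒯 : ∀ M ∈ K, fullSignature M E s ∈ 𝒯) :
    K.card ≤ (K.image circuitHyperplanes).card *
      (𝒯.card * (boundedSubsets (E.powersetCard r) t).card) := by
  rw [← Finset.card_product, ← Finset.card_product]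
  refine Finset.card_le_card_of_injOn (fun M => (circuitHyperplanes M,
    fullSignature M E s, freeRepresentatives E r s M)) (fun M hM => ?_) fun M hM N hN h => ?_
  · have hM' := Finset.mem_coe.1 hM
    refine Finset.mem_coe.2 (Finset.mem_product.2 ⟨Finset.mem_image_of_mem _ hM',
      Finset.mem_product.2 ⟨h𝒯 M hM', mem_boundedSubsets.2 ⟨?_, ht M hM'⟩⟩⟩)
    intro V hV
    have hVa := (Finset.mem_filter.1 (mem_freeRepresentatives.1 hV).1).1
    exact Finset.mem_powersetCard.2 ⟨subset_of_mem_ambiguous hVa, card_of_mem_ambiguous hVa⟩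
  · have hM' := Finset.mem_coe.1 hM
    have hN' := Finset.mem_coe.1 hN
    simp only [Prod.mk.injEq] at h
    exact eq_of_circuitHyperplanes_eq (hK M hM') (hK N hN') (hl M hM') (hc M hM') (hl N hN')
      (hc N hN') h.2.1 h.1 h.2.2

/-! ### The number of signatures -/

section
variable {α : Type*} [DecidableEq α] {E : Finset α} {r s : ℕ} {M : Matroid α}

theorem mem_seeds (hM : M ∈ MatroidsOn E r) {X : Finset α} : X ∈ seeds M E s ↔
    IsSeed M s X ∧ seedOf M s (M.closure X) = X := by
  simp only [seeds, Finset.mem_filter, Finset.mem_powerset, and_iff_right_iff_imp]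
  rintro ⟨h, -⟩
  have := h.1
  rw [hM.1] at this
  exact_mod_cast this

theorem card_of_isSeed (hM : M ∈ MatroidsOn E r) {X : Finset α} (hX : IsSeed M s X) :
    X.card = r := by
  have := hX.2.1.symm.trans hX.2.2.1
  rw [hM.2] at this
  exact_mod_cast this

theorem mem_seedExtensions (hM : M ∈ MatroidsOn E r) {Q : Finset α} :
    Q ∈ seedExtensions M E s ↔ NoShortCircuit M s Q ∧
      ∃ X ∈ seeds M E s, ∃ y ∈ M.closure X, y ∉ X ∧ Q = insert y X := by
  simp only [seedExtensions, Finset.mem_filter, Finset.mem_powerset, and_iff_right_iff_imp]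
  rintro ⟨-, X, hX, y, hy, -, rfl⟩
  have h1 := ((mem_seeds hM).1 hX).1.1
  have h2 := M.closure_subset_ground _ hy
  rw [hM.1] at h1 h2
  exact Finset.insert_subset (by exact_mod_cast h2) (by exact_mod_cast h1)

theorem seeds_subset_powersetCard (hM : M ∈ MatroidsOn E r) :
    seeds M E s ⊆ E.powersetCard r := by
  intro X hX
  refine Finset.mem_powersetCard.2 ⟨?_, card_of_isSeed hM ((mem_seeds hM).1 hX).1⟩
  simp only [seeds, Finset.mem_filter, Finset.mem_powerset] at hX
  exact hX.1

theorem seedExtensions_subset_powersetCard (hM : M ∈ MatroidsOn E r) :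
    seedExtensions M E s ⊆ E.powersetCard (r + 1) := by
  intro Q hQ
  have hQE : Q ⊆ E := by
    simp only [seedExtensions, Finset.mem_filter, Finset.mem_powerset] at hQ
    exact hQ.1
  refine Finset.mem_powersetCard.2 ⟨hQE, ?_⟩
  obtain ⟨-, X, hX, y, -, hy, rfl⟩ := (mem_seedExtensions hM).1 hQ
  rw [Finset.card_insert_of_notMem hy, card_of_isSeed hM ((mem_seeds hM).1 hX).1]

theorem card_seeds_le (hM : M ∈ MatroidsOn E r) :
    (seeds M E s).card ≤ (seedExtensions M E s).card := by
  refine (Finset.card_le_card (t := (seedExtensions M E s).image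
    fun Q : Finset α => seedOf M s (M.closure Q)) fun X hX => ?_).trans Finset.card_image_le
  obtain ⟨hX1, hX2⟩ := (mem_seeds hM).1 hX
  obtain ⟨-, -, -, y, hy, hyX, hno⟩ := id hX1
  refine Finset.mem_image.2
    ⟨insert y X, (mem_seedExtensions hM).2 ⟨hno, X, hX, y, hy, hyX, rfl⟩, ?_⟩
  rw [Finset.coe_insert, Matroid.closure_insert_eq_of_mem_closure hy, hX2]

/-- A seed extension `Q` contains many bases of the hyperplane that it spans, and `Q` can be
recovered from any of them. -/
theorem sq_le_card_filter (hM : M ∈ MatroidsOn E r) {Q : Finset α}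
    (hQ : Q ∈ seedExtensions M E s) :
    s * s ≤ 2 * {B ∈ E.powersetCard (r - 1) | B ∪ seedOf M s (M.closure B) = Q}.card := by
  have hQE := (Finset.mem_powersetCard.1 (seedExtensions_subset_powersetCard hM hQ)).1
  obtain ⟨hno, X, hX, y, hy, hyX, rfl⟩ := (mem_seedExtensions hM).1 hQ
  obtain ⟨hX1, hX2⟩ := (mem_seeds hM).1 hX
  have hXr := card_of_isSeed hM hX1
  have hXrk : M.eRk X + 1 = r := by rw [hX1.2.1, hXr]
  have long : ∀ C : Finset α, M.IsCircuit C → C ⊆ insert y X → s + 1 ≤ C.card := by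
    intro C hC hCQ
    by_contra h
    exact hno C (by omega) hC hCQ
  have hdep : M.Dep X := by
    refine (Matroid.not_indep_iff hX1.1).1 fun h => ?_
    have := h.eRk_eq_encard
    rw [Set.encard_coe_eq_coe_finsetCard, hXr] at this
    rw [this] at hXrk
    norm_cast at hXrk
    omega
  obtain ⟨C', hCX', hC⟩ := hdep.exists_isCircuit_subset
  obtain ⟨C, rfl⟩ := MatroidsOn.exists_finset hM hC.subset_ground
  have hCX : C ⊆ X := by exact_mod_cast hCX'
  -- Deleting any element of `C` from `X` leaves a basis of the hyperplane
  have hcl : ∀ u ∈ C, M.closure ((X : Set α) \ {u}) = M.closure X := fun u hu =>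
    Matroid.closure_sdiff_singleton_eq_closure (M.closure_subset_closure
      (Set.sdiff_subset_sdiff_left hCX') (hC.mem_closure_sdiff_singleton_of_mem
        (by exact_mod_cast hu)))
  have hind : ∀ u ∈ C, M.Indep ((X : Set α) \ {u}) := by
    intro u hu
    rw [Matroid.indep_iff_eRk_eq_encard_of_finite (X.finite_toSet.subset Set.sdiff_subset),
      ← M.eRk_closure_eq, hcl u hu, M.eRk_closure_eq, ← Finset.coe_erase,
      Set.encard_coe_eq_coe_finsetCard, Finset.card_erase_of_mem (hCX hu), hXr]
    have hpos : 1 ≤ r := by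
      rw [← hXr]; exact Finset.card_pos.2 ⟨u, hCX hu⟩
    have hne : M.eRk X ≠ ⊤ := ((M.eRk_le_encard _).trans_lt X.finite_toSet.encard_lt_top).ne
    lift M.eRk X to ℕ using hne with a
    norm_cast at hXrk ⊢
    omega
  have hD : ∀ u, ∃ D : Finset α, u ∈ C → M.IsCircuit D ∧ D ⊆ insert y (X.erase u) ∧ y ∈ D := by
    intro u
    by_cases hu : u ∈ C
    · obtain ⟨D', hD1, hD2, hD3⟩ := Matroid.exists_isCircuit_of_mem_closure
        (M := M) (e := y) (X := (X : Set α) \ {u}) (by rwa [hcl u hu])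
        (fun h => hyX (by exact_mod_cast h.1))
      obtain ⟨D, rfl⟩ := MatroidsOn.exists_finset hM hD2.subset_ground
      rw [← Finset.coe_erase, ← Finset.coe_insert] at hD1
      exact ⟨D, fun _ => ⟨hD2, by exact_mod_cast hD1, by exact_mod_cast hD3⟩⟩
    · exact ⟨∅, fun h => absurd h hu⟩
  choose D hD using hD
  -- The bases are obtained by removing `u ∈ C` and then another element `v` of a circuit through
  -- `y` that avoids `u`. As both circuits are long, there are at least `s ^ 2` ordered pairs
  -- `(u, v)`.
  let T : Finset ((_ : α) × α) := C.sigma fun u => (D u).erase y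
  have hT : s * s ≤ T.card := by
    rw [Finset.card_sigma]
    calc s * s ≤ C.card * s := Nat.mul_le_mul_right _ ((Nat.le_succ s).trans
          (long C hC (hCX.trans (Finset.subset_insert _ _))))
      _ = ∑ u ∈ C, s := by simp
      _ ≤ _ := by
        refine Finset.sum_le_sum fun u hu => ?_
        obtain ⟨h1, h2, h3⟩ := hD u hu
        rw [Finset.card_erase_of_mem h3]
        have := long (D u) h1 (h2.trans (Finset.insert_subset_insert _ (Finset.erase_subset _ _)))
        omega
  have hTp : ∀ p ∈ T, p.1 ∈ C ∧ p.2 ∈ D p.1 ∧ p.2 ≠ y ∧ p.1 ∈ X ∧ p.2 ∈ X ∧ p.1 ≠ p.2 := by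
    rintro ⟨u, v⟩ h
    have h' := Finset.mem_sigma.1 h
    have hv := Finset.mem_erase.1 h'.2
    have hv2 := Finset.mem_erase.1
      ((Finset.mem_insert.1 ((hD u h'.1).2.1 hv.2)).resolve_left hv.1)
    exact ⟨h'.1, hv.2, hv.1, hCX h'.1, hv2.2, hv2.1.symm⟩
  let f : ((_ : α) × α) → Finset α := fun p => ((insert y X).erase p.1).erase p.2
  refine hT.trans ((Finset.card_le_mul_card_image (f := f) T 2 fun B hB => ?_).trans
    (Nat.mul_le_mul_left _ (Finset.card_le_card ?_)))
  · -- The pair removed from `Q` is determined up to its order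
    obtain ⟨⟨u₀, v₀⟩, h₀, rfl⟩ := Finset.mem_image.1 hB
    refine (Finset.card_le_card (t := {⟨u₀, v₀⟩, ⟨v₀, u₀⟩}) ?_).trans Finset.card_le_two
    rintro ⟨u, v⟩ h
    obtain ⟨hp, hf⟩ := Finset.mem_filter.1 h
    obtain ⟨-, -, h1, h2, h3, h4⟩ := hTp _ h₀
    obtain ⟨-, -, h1', h2', h3', h4'⟩ := hTp _ hp
    have key : ∀ x ∈ X, (x = u ∨ x = v ↔ x = u₀ ∨ x = v₀) := by
      intro x hx
      have := congrArg (x ∈ ·) hf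
      simp only [f, Finset.mem_erase, Finset.mem_insert, hx, or_true, and_true, eq_iff_iff] at this
      tauto
    have a1 := (key u h2').1 (Or.inl rfl)
    have a2 := (key v h3').1 (Or.inr rfl)
    simp only [Finset.mem_insert, Finset.mem_singleton, Sigma.mk.injEq, heq_eq_eq]
    simp only at h4'
    rcases a1 with rfl | rfl <;> rcases a2 with rfl | rfl <;> simp_all
  · intro B hB
    obtain ⟨⟨u, v⟩, hp, rfl⟩ := Finset.mem_image.1 hB
    obtain ⟨huC, hvD, hvy, huX, hvX, huv⟩ := hTp _ hp
    simp only at huC hvD hvy huX hvX huv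
    have huy : u ≠ y := by rintro rfl; exact hyX huX
    have hBeq : ((f ⟨u, v⟩ : Finset α) : Set α) = insert y ((X : Set α) \ {u}) \ {v} := by
      ext x
      simp only [f, Finset.coe_erase, Finset.coe_insert, Set.mem_sdiff, Set.mem_insert_iff,
        Set.mem_singleton_iff]
      by_cases hx : x = y
      · subst hx; simp [huy.symm]
      · simp [hx]
    have hBcl : M.closure (f ⟨u, v⟩ : Finset α) = M.closure X := by
      rw [hBeq, (hind u huC).closure_insert_sdiff_eq_of_mem_closure (by rwa [hcl u huC]) ?_,
        hcl u huC]
      obtain ⟨h1, h2, h3⟩ := hD u huC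
      refine M.closure_subset_closure ?_
        (h1.mem_closure_sdiff_singleton_of_mem (by exact_mod_cast hvD))
      refine Set.sdiff_subset_sdiff_left ?_
      rw [← Finset.coe_erase, ← Finset.coe_insert]
      exact_mod_cast h2
    refine Finset.mem_filter.2 ⟨Finset.mem_powersetCard.2 ⟨?_, ?_⟩, ?_⟩
    · exact (Finset.erase_subset _ _).trans ((Finset.erase_subset _ _).trans hQE)
    · have h1 : u ∈ insert y X := Finset.mem_insert_of_mem huX
      have h2 : v ∈ (insert y X).erase u :=
        Finset.mem_erase.2 ⟨huv.symm, Finset.mem_insert_of_mem hvX⟩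
      simp only [f]
      rw [Finset.card_erase_of_mem h2, Finset.card_erase_of_mem h1,
        Finset.card_insert_of_notMem hyX, hXr]
      omega
    · rw [hBcl, hX2]
      ext x
      simp only [f, Finset.mem_union, Finset.mem_erase, Finset.mem_insert]
      by_cases hx : x = y
      · subst hx; simp [huy.symm, hvy.symm]
      · simp [hx]

/-- A double count of the pairs of a seed extension `Q` and an `(r - 1)`-set from which `Q` is
recovered. -/
theorem card_seedExtensions_mul_le (hM : M ∈ MatroidsOn E r) :
    (seedExtensions M E s).card * (s * s) ≤ 2 * E.card.choose (r - 1) := by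
  calc (seedExtensions M E s).card * (s * s) = ∑ Q ∈ seedExtensions M E s, s * s := by simp
    _ ≤ ∑ Q ∈ seedExtensions M E s,
        2 * {B ∈ E.powersetCard (r - 1) | B ∪ seedOf M s (M.closure B) = Q}.card :=
        Finset.sum_le_sum fun Q hQ => sq_le_card_filter hM hQ
    _ = 2 * ∑ Q ∈ seedExtensions M E s,
        {B ∈ E.powersetCard (r - 1) | B ∪ seedOf M s (M.closure B) = Q}.card := by
        rw [Finset.mul_sum]
    _ ≤ 2 * (E.powersetCard (r - 1)).card := by
        refine Nat.mul_le_mul_left _ ?_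
        rw [Finset.sum_card_fiberwise_eq_card_filter]
        exact Finset.card_filter_le _ _
    _ = _ := by rw [Finset.card_powersetCard]

/-- A finite set that contains the signatures of all matroids in `MatroidsOn E r`. -/
def signatureRange {α : Type*} (E : Finset α) (r s q : ℕ) : Finset (SignatureData α) :=
  (boundedSubsets E s).powerset ×ˢ boundedSubsets (E.powersetCard r) q ×ˢ
    boundedSubsets (E.powersetCard (r + 1)) q

theorem signature_mem_signatureRange (hM : M ∈ MatroidsOn E r) {q : ℕ} (hs : 0 < s)
    (hq : 2 * E.card.choose (E.card / 2) / (s * s) ≤ q) :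
    signature M E s ∈ signatureRange E r s q := by
  have h : (seedExtensions M E s).card ≤ q := by
    refine le_trans ?_ hq
    rw [Nat.le_div_iff_mul_le (by positivity)]
    exact (card_seedExtensions_mul_le hM).trans
      (Nat.mul_le_mul_left _ (Nat.choose_le_middle _ _))
  refine Finset.mem_product.2 ⟨Finset.mem_powerset.2 fun C hC => ?_, Finset.mem_product.2
    ⟨mem_boundedSubsets.2 ⟨seeds_subset_powersetCard hM, (card_seeds_le hM).trans h⟩,
      mem_boundedSubsets.2 ⟨seedExtensions_subset_powersetCard hM, h⟩⟩⟩
  simp only [signature, shortCircuits, Finset.mem_filter, Finset.mem_powerset] at hC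
  exact mem_boundedSubsets.2 ⟨hC.1, hC.2.1⟩

theorem card_signatureRange_le {α : Type*} (E : Finset α) (r s : ℕ) {q : ℕ} {y : ℝ} (hy : 1 ≤ y) :
    ((signatureRange E r s q).card : ℝ) ≤ 2 ^ (boundedSubsets E s).card *
      (y ^ q * (1 + 1 / y) ^ E.card.choose (E.card / 2)) ^ 2 := by
  have h : ∀ k, ((boundedSubsets (E.powersetCard k) q).card : ℝ) ≤
      y ^ q * (1 + 1 / y) ^ E.card.choose (E.card / 2) := by
    intro k
    refine (card_boundedSubsets_le _ _ hy).trans ?_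
    rw [Finset.card_powersetCard]
    have : (0 : ℝ) ≤ 1 / y := by positivity
    gcongr
    · linarith
    · exact Nat.choose_le_middle _ _
  rw [signatureRange, Finset.card_product, Finset.card_product, Finset.card_powerset]
  push_cast
  rw [sq]
  gcongr
  · exact h r
  · exact h (r + 1)

end

/-! ### Loops and principal extensions -/

section
variable {α : Type*}

open Set in
/-- A loop `e` of a finite matroid can be replaced by an element placed freely in the flat spanned
by `F`: the principal extension. -/
theorem exists_principalExtension (M : Matroid α) [M.Finite] {e : α} (he : M.IsLoop e)
    {F : Set α} (hF : F ⊆ M.E) : ∃ N : Matroid α, N.E = M.E ∧ N.eRank = M.eRank ∧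
      ∀ J, N.Indep J ↔ (e ∉ J ∧ M.Indep J) ∨
        (e ∈ J ∧ M.Indep (J \ {e}) ∧ ¬ F ⊆ M.closure (J \ {e})) := by
  have hEfin : M.E.Finite := M.ground_finite
  let P : Set α → Prop := fun J => (e ∉ J ∧ M.Indep J) ∨
        (e ∈ J ∧ M.Indep (J \ {e}) ∧ ¬ F ⊆ M.closure (J \ {e}))
  have hPi : ∀ {J}, P J → M.Indep (J \ {e}) := by
    rintro J (⟨h, h'⟩ | ⟨h, h', -⟩)
    · exact h'.subset sdiff_subset
    · exact h'
  have hsub : ∀ ⦃I J⦄, P J → I ⊆ J → P I := by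
    intro I J hJ hIJ
    have hi := (hPi hJ).subset (sdiff_subset_sdiff_left (t := {e}) hIJ)
    by_cases heI : e ∈ I
    · rcases hJ with ⟨h, -⟩ | ⟨-, -, h⟩
      · exact absurd (hIJ heI) h
      · exact Or.inr ⟨heI, hi, fun h' => h (h'.trans (M.closure_subset_closure
          (sdiff_subset_sdiff_left hIJ)))⟩
    · rw [sdiff_singleton_eq_self heI] at hi
      exact Or.inl ⟨heI, hi⟩
  -- If no element of `B` can be added to `A`, then `B` lies in the flat spanned by `A` and `f`
  have hspan : ∀ {A B : Set α}, e ∈ A → M.Indep (A \ {e}) → M.Indep (B \ {e}) →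
      (∀ x ∈ B, x ∉ A → ¬ P (insert x A)) → ∀ f ∈ F, f ∉ M.closure (A \ {e}) →
      B \ {e} ⊆ M.closure (insert f (A \ {e})) := by
    intro A B heA hA hB hno f hf hfA x hx
    have hmono := M.closure_subset_closure (subset_insert f (A \ {e}))
    by_cases hxcl : x ∈ M.closure (A \ {e})
    · exact hmono hxcl
    have hxE : x ∈ M.E := hB.subset_ground hx
    have hxA : x ∉ A := fun h => hxcl (M.mem_closure_of_mem ⟨h, hx.2⟩ hA.subset_ground)
    have hxe : x ≠ e := hx.2
    have heq : insert x A \ {e} = insert x (A \ {e}) := by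
      rw [insert_sdiff_of_notMem _ (by simpa using hxe)]
    have h1 : F ⊆ M.closure (insert x (A \ {e})) := by
      by_contra h
      refine hno x hx.1 hxA (Or.inr ⟨mem_insert_of_mem _ heA, ?_, ?_⟩)
      · rw [heq]
        exact (hA.insert_indep_iff).2 (Or.inl ⟨hxE, hxcl⟩)
      · rwa [heq]
    exact (M.closure_exchange ⟨h1 hf, hfA⟩).1
  have haug : ∀ ⦃A B⦄, P A → P B → A.ncard < B.ncard → ∃ x ∈ B, x ∉ A ∧ P (insert x A) := by
    intro A B hA hB hAB
    have hA' := hPi hA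
    have hB' := hPi hB
    have hfinA0 := hEfin.subset hA'.subset_ground
    have hfinB0 := hEfin.subset hB'.subset_ground
    have hBfin : B.Finite := by
      refine (hfinB0.union (finite_singleton e)).subset fun x hx => ?_
      by_cases h : x = e
      · exact Or.inr h
      · exact Or.inl ⟨hx, h⟩
    have hAfin : A.Finite := by
      refine (hfinA0.union (finite_singleton e)).subset fun x hx => ?_
      by_cases h : x = e
      · exact Or.inr h
      · exact Or.inl ⟨hx, h⟩
    by_contra! hno
    by_cases heA : e ∈ A
    · have hcardA : (A \ {e}).ncard + 1 = A.ncard := ncard_sdiff_singleton_add_one heA hAfin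
      have hFA : ¬ F ⊆ M.closure (A \ {e}) := by
        rcases hA with h | h
        · exact absurd heA h.1
        · exact h.2.2
      obtain ⟨f, hf, hfA⟩ := not_subset.1 hFA
      have hle : (B \ {e}).ncard ≤ (A \ {e}).ncard + 1 := by
        have h1 := M.eRk_mono (hspan heA hA' hB' hno f hf hfA)
        rw [M.eRk_closure_eq, hB'.eRk_eq_encard] at h1
        have h2 := h1.trans ((M.eRk_le_encard _).trans (encard_insert_le _ _))
        rw [← hfinA0.cast_ncard_eq, ← hfinB0.cast_ncard_eq] at h2
        exact_mod_cast h2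
      by_cases heB : e ∈ B
      · have hcardB : (B \ {e}).ncard + 1 = B.ncard := ncard_sdiff_singleton_add_one heB hBfin
        have hFB : ¬ F ⊆ M.closure (B \ {e}) := by
          rcases hB with h | h
          · exact absurd heB h.1
          · exact h.2.2
        refine hFB fun g hg => ?_
        have hcl : ∀ g ∈ F, g ∉ M.closure (A \ {e}) →
            M.closure (B \ {e}) = M.closure (insert g (A \ {e})) := by
          intro g hg hgA
          have h3 := (M.isRkFinite_of_finite hfinB0).closure_eq_closure_of_subset_of_eRk_ge_eRk
            (hspan heA hA' hB' hno g hg hgA) ?_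
          · rw [h3, M.closure_closure]
          · rw [M.eRk_closure_eq, hB'.eRk_eq_encard]
            refine (M.eRk_le_encard _).trans ((encard_insert_le _ _).trans ?_)
            rw [← hfinA0.cast_ncard_eq, ← hfinB0.cast_ncard_eq]
            have : (A \ {e}).ncard + 1 ≤ (B \ {e}).ncard := by omega
            exact_mod_cast this
        by_cases hgA : g ∈ M.closure (A \ {e})
        · rw [hcl f hf hfA]
          exact M.closure_subset_closure (subset_insert _ _) hgA
        · rw [hcl g hg hgA]
          exact M.mem_closure_of_mem (mem_insert _ _)
            (insert_subset (hF hg) hA'.subset_ground)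
      · rw [sdiff_singleton_eq_self heB] at hle
        omega
    · rw [sdiff_singleton_eq_self heA] at hA' hfinA0
      have hcl : B \ {e} ⊆ M.closure A := by
        intro x hx
        by_contra hxA
        have hx' : x ∉ A := fun h => hxA (M.mem_closure_of_mem h hA'.subset_ground)
        refine hno x hx.1 hx' (Or.inl ⟨?_, ?_⟩)
        · simp only [mem_insert_iff, not_or]
          exact ⟨fun h => hx.2 h.symm, heA⟩
        · exact (hA'.insert_indep_iff).2 (Or.inl ⟨hB'.subset_ground hx, hxA⟩)
      have hle : (B \ {e}).ncard ≤ A.ncard := by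
        have h1 := M.eRk_mono hcl
        rw [M.eRk_closure_eq, hB'.eRk_eq_encard, hA'.eRk_eq_encard,
          ← hfinA0.cast_ncard_eq, ← hfinB0.cast_ncard_eq] at h1
        exact_mod_cast h1
      by_cases heB : e ∈ B
      · have hcardB : (B \ {e}).ncard + 1 = B.ncard := ncard_sdiff_singleton_add_one heB hBfin
        have hFB : ¬ F ⊆ M.closure (B \ {e}) := by
          rcases hB with h | h
          · exact absurd heB h.1
          · exact h.2.2
        have hFA : F ⊆ M.closure A := by
          by_contra h
          refine hno e heB heA (Or.inr ⟨mem_insert _ _, ?_, ?_⟩) <;>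
            rwa [insert_sdiff_of_mem _ (mem_singleton e), sdiff_singleton_eq_self heA]
        apply hFB
        have h3 := (M.isRkFinite_of_finite hfinB0).closure_eq_closure_of_subset_of_eRk_ge_eRk hcl ?_
        · rwa [h3, M.closure_closure]
        · rw [M.eRk_closure_eq, hB'.eRk_eq_encard, hA'.eRk_eq_encard,
            ← hfinA0.cast_ncard_eq, ← hfinB0.cast_ncard_eq]
          have : A.ncard ≤ (B \ {e}).ncard := by omega
          exact_mod_cast this
      · rw [sdiff_singleton_eq_self heB] at hle
        omega
  let N : Matroid α := (IndepMatroid.ofFinite hEfin P (Or.inl ⟨notMem_empty e, M.empty_indep⟩)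
    hsub haug (fun I hI x hx => by
      by_cases h : x = e
      · rw [h]; exact he.mem_ground
      · exact (hPi hI).subset_ground ⟨hx, h⟩)).matroid
  have hN : ∀ J, N.Indep J ↔ P J := fun J => Iff.rfl
  refine ⟨N, rfl, ?_, hN⟩
  obtain ⟨B, hB⟩ := M.exists_isBase
  have heB : e ∉ B := he.notMem_of_indep hB.indep
  have hNB : N.IsBase B := by
    rw [Matroid.isBase_iff_maximal_indep]
    refine ⟨(hN B).2 (Or.inl ⟨heB, hB.indep⟩), fun J hJ hBJ => ?_⟩
    rcases (hN J).1 hJ with ⟨-, h⟩ | ⟨-, -, h⟩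
    · exact (hB.eq_of_subset_indep h hBJ).superset
    · have hBJ' : B ⊆ J \ {e} := fun x hx => ⟨hBJ hx, by rintro rfl; exact heB hx⟩
      exact absurd (hF.trans_eq (hB.closure_of_superset hBJ').symm) h
  rw [← hNB.encard_eq_eRank, hB.encard_eq_eRank]

theorem finite_matroidsOn (E : Finset α) (r : ℕ) : (MatroidsOn E r).Finite :=
  (Matroid.finite_setOfPred_matroid' E.finite_toSet).subset fun _ hM => hM.1

/-- The finite set of matroids of rank `r` on `E`. -/
noncomputable def matroidFinset (E : Finset α) (r : ℕ) : Finset (Matroid α) :=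
  (finite_matroidsOn E r).toFinset

theorem mem_matroidFinset {E : Finset α} {r : ℕ} {M : Matroid α} :
    M ∈ matroidFinset E r ↔ M ∈ MatroidsOn E r := by
  simp [matroidFinset]

open Classical in
/-- A given element is a loop in only a fraction `2⁻ʳ` of the matroids of rank `r`: it can be moved
freely to any of the `2 ^ r` flats spanned by a subset of a fixed basis. -/
theorem card_isLoop_mul_two_pow_le (E : Finset α) (r : ℕ) (e : α) :
    {M ∈ matroidFinset E r | M.IsLoop e}.card * 2 ^ r ≤ (matroidFinset E r).card := by
  have hb : ∀ M : Matroid α, ∃ B : Finset α, M ∈ MatroidsOn E r → M.IsBase B := by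
    intro M
    by_cases hM : M ∈ MatroidsOn E r
    · obtain ⟨B, hB⟩ := M.exists_isBase
      obtain ⟨B', rfl⟩ := MatroidsOn.exists_finset hM hB.subset_ground
      exact ⟨B', fun _ => hB⟩
    · exact ⟨∅, fun h => absurd h hM⟩
  choose b hb using hb
  have hext : ∀ (M : Matroid α) (F : Finset α), ∃ N : Matroid α, M ∈ MatroidsOn E r →
      M.IsLoop e → F ⊆ b M → N.E = M.E ∧ N.eRank = M.eRank ∧
      ∀ J, N.Indep J ↔ (e ∉ J ∧ M.Indep J) ∨
        (e ∈ J ∧ M.Indep (J \ {e}) ∧ ¬ (F : Set α) ⊆ M.closure (J \ {e})) := by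
    intro M F
    by_cases h : M ∈ MatroidsOn E r ∧ M.IsLoop e ∧ F ⊆ b M
    · have := MatroidsOn.finite h.1
      obtain ⟨N, hN⟩ := exists_principalExtension M h.2.1
        ((Finset.coe_subset.2 h.2.2).trans (hb M h.1).subset_ground)
      exact ⟨N, fun _ _ _ => hN⟩
    · exact ⟨M, fun h1 h2 h3 => absurd ⟨h1, h2, h3⟩ h⟩
  choose N hN using hext
  set K := {M ∈ matroidFinset E r | M.IsLoop e} with hK
  have hK' : ∀ M ∈ K, M ∈ MatroidsOn E r ∧ M.IsLoop e := fun M hM => by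
    have := Finset.mem_filter.1 hM
    exact ⟨mem_matroidFinset.1 this.1, this.2⟩
  calc K.card * 2 ^ r = ∑ M ∈ K, (b M).powerset.card := by
        rw [← smul_eq_mul, ← Finset.sum_const]
        refine Finset.sum_congr rfl fun M hM => ?_
        have := hK' M hM
        rw [Finset.card_powerset,
          (Finset.mem_powersetCard.1 (MatroidsOn.isBase_card this.1 (hb M this.1))).2]
    _ = (K.sigma fun M => (b M).powerset).card := (Finset.card_sigma _ _).symm
    _ ≤ (matroidFinset E r).card := by
        refine Finset.card_le_card_of_injOn (fun p => N p.1 p.2) ?_ ?_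
        · rintro ⟨M, F⟩ h
          simp only [Finset.coe_sigma, Set.mem_sigma_iff, Finset.mem_coe,
            Finset.mem_powerset] at h
          obtain ⟨hM, he⟩ := hK' M h.1
          obtain ⟨h1, h2, -⟩ := hN M F hM he h.2
          exact Finset.mem_coe.2 (mem_matroidFinset.2 ⟨h1.trans hM.1, h2.trans hM.2⟩)
        · rintro ⟨M, F⟩ h ⟨M', F'⟩ h' heq
          simp only [Finset.coe_sigma, Set.mem_sigma_iff, Finset.mem_coe,
            Finset.mem_powerset] at h h' heq
          obtain ⟨hM, he⟩ := hK' M h.1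
          obtain ⟨hM', he'⟩ := hK' M' h'.1
          obtain ⟨-, -, h1⟩ := hN M F hM he h.2
          obtain ⟨-, -, h1'⟩ := hN M' F' hM' he' h'.2
          have hMM : M = M' := by
            refine Matroid.ext_indep (hM.1.trans hM'.1.symm) fun J _ => ?_
            have key : ∀ {M₀ N₀ : Matroid α} {F₀ : Finset α}, M₀.IsLoop e →
                (∀ J, N₀.Indep J ↔ (e ∉ J ∧ M₀.Indep J) ∨ (e ∈ J ∧ M₀.Indep (J \ {e}) ∧
                  ¬ (F₀ : Set α) ⊆ M₀.closure (J \ {e}))) →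
                (M₀.Indep J ↔ e ∉ J ∧ N₀.Indep J) := by
              intro M₀ N₀ F₀ he₀ h₀
              rw [h₀]
              refine ⟨fun h => ⟨he₀.notMem_of_indep h, Or.inl ⟨he₀.notMem_of_indep h, h⟩⟩, ?_⟩
              rintro ⟨h2, h3 | h3⟩
              · exact h3.2
              · exact absurd h3.1 h2
            rw [key he h1, key he' h1', heq]
          subst hMM
          have hB := hb M hM
          have key : ∀ {F₀ G : Finset α}, F₀ ⊆ b M → G ⊆ b M →
              (∀ J, (N M F₀).Indep J ↔ (e ∉ J ∧ M.Indep J) ∨ (e ∈ J ∧ M.Indep (J \ {e}) ∧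
                  ¬ (F₀ : Set α) ⊆ M.closure (J \ {e}))) →
              (F₀ ⊆ G ↔ ¬ (N M F₀).Indep (insert e (G : Set α))) := by
            intro F₀ G hF₀ hG h₀
            have hGi : M.Indep G := hB.indep.subset (by exact_mod_cast hG)
            have heG : e ∉ (G : Set α) := he.notMem_of_indep hGi
            rw [h₀, Set.insert_sdiff_of_mem _ (Set.mem_singleton e),
              Set.sdiff_singleton_eq_self heG]
            have hcl := hB.indep.closure_inter_eq_self_of_subset (Finset.coe_subset.2 hG)
            have : (F₀ : Set α) ⊆ M.closure G ↔ F₀ ⊆ G := by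
              rw [← Finset.coe_subset, ← hcl, Set.subset_inter_iff, hcl]
              exact ⟨fun h => ⟨h, Finset.coe_subset.2 hF₀⟩, fun h => h.1⟩
            simp [hGi, this]
          have hFF : F = F' := by
            refine subset_antisymm ?_ ?_
            · rw [key h.2 h'.2 h1, heq, ← key h'.2 h'.2 h1']
            · rw [key h'.2 h.2 h1', ← heq, ← key h.2 h.2 h1]
          rw [hFF]

end

/-! ### Sparse paving matroids and the lower bound on the number of matroids -/

section
variable {α : Type*}

theorem JohnsonAdj.insert_insert [DecidableEq α] {Z : Finset α} {u v : α} (hu : u ∉ Z) (hv : v ∉ Z)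
    (huv : u ≠ v) : JohnsonAdj (insert u Z) (insert v Z) :=
  ⟨u, Finset.mem_insert_self _ _, v, by simp [huv.symm, hv], by rw [Finset.erase_insert hu]⟩

/-- The complement of a stable set in the Johnson graph is the family of bases of a matroid (a
sparse paving matroid). -/
theorem exists_sparsePaving [DecidableEq α] {E : Finset α} {r : ℕ} (hr : 0 < r) (hrE : r < E.card)
    {𝒮 : Finset (Finset α)} (h𝒮 : IsStable 𝒮) :
    ∃ M ∈ MatroidsOn E r, ∀ X : Finset α, M.IsBase X ↔ X ∈ E.powersetCard r ∧ X ∉ 𝒮 := by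
  let P : Set α → Prop := fun B => ∃ X : Finset α, (X : Set α) = B ∧ X ∈ E.powersetCard r ∧ X ∉ 𝒮
  have hP : ∀ X : Finset α, P X ↔ X ∈ E.powersetCard r ∧ X ∉ 𝒮 := by
    intro X
    refine ⟨?_, fun h => ⟨X, rfl, h⟩⟩
    rintro ⟨Y, hY, h⟩
    rwa [← Finset.coe_injective hY]
  have hex : ∃ X : Finset α, X ∈ E.powersetCard r ∧ X ∉ 𝒮 := by
    obtain ⟨X, hXE, hX⟩ := Finset.exists_subset_card_eq hrE.le
    by_cases h : X ∈ 𝒮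
    · obtain ⟨u, hu⟩ : X.Nonempty := Finset.card_pos.1 (hX ▸ hr)
      obtain ⟨v, hvE, hv⟩ := Finset.exists_mem_notMem_of_card_lt_card (hX ▸ hrE)
      refine ⟨insert v (X.erase u), Finset.mem_powersetCard.2 ⟨?_, ?_⟩,
        fun h' => h𝒮 _ h _ h' ⟨u, hu, v, hv, rfl⟩⟩
      · exact Finset.insert_subset hvE ((Finset.erase_subset _ _).trans hXE)
      · rw [Finset.card_insert_of_notMem (fun h => hv (Finset.mem_of_mem_erase h)),
          Finset.card_erase_add_one hu, hX]
    · exact ⟨X, Finset.mem_powersetCard.2 ⟨hXE, hX⟩, h⟩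
  have hexch : Matroid.ExchangeProperty P := by
    rintro _ _ ⟨X, rfl, hX, -⟩ ⟨Y, rfl, hY, hY𝒮⟩ a ⟨haX, haY⟩
    rw [Finset.mem_coe] at haX haY
    have hX' := Finset.mem_powersetCard.1 hX
    have hY' := Finset.mem_powersetCard.1 hY
    have hcoe : ∀ b, insert b ((X : Set α) \ {a}) =
        ((insert b (X.erase a) : Finset α) : Set α) := by
      intro b; simp
    have hmem : ∀ b ∈ Y \ X, insert b (X.erase a) ∈ E.powersetCard r := by
      intro b hb
      rw [Finset.mem_sdiff] at hb
      refine Finset.mem_powersetCard.2 ⟨Finset.insert_subset (hY'.1 hb.1)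
        ((Finset.erase_subset _ _).trans hX'.1), ?_⟩
      rw [Finset.card_insert_of_notMem (fun h => hb.2 (Finset.mem_of_mem_erase h)),
          Finset.card_erase_add_one haX, hX'.2]
    have hcard : (X \ Y).card = (Y \ X).card :=
      Finset.card_sdiff_comm (hX'.2.trans hY'.2.symm)
    obtain ⟨b, hb⟩ : (Y \ X).Nonempty := by
      rw [← Finset.card_pos, ← hcard, Finset.card_pos]
      exact ⟨a, Finset.mem_sdiff.2 ⟨haX, haY⟩⟩
    by_cases hb𝒮 : insert b (X.erase a) ∈ 𝒮
    · obtain ⟨c, hc, hcb⟩ : ∃ c ∈ Y \ X, c ≠ b := by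
        by_contra! hall
        have h1 : (Y \ X).card = 1 := Finset.card_eq_one.2 ⟨b, Finset.eq_singleton_iff_unique_mem.2
          ⟨hb, hall⟩⟩
        obtain ⟨a', ha'⟩ := Finset.card_eq_one.1 (hcard.trans h1)
        have haa : ∀ x, x ∈ X → x ∉ Y → x = a := by
          intro x hx hxY
          have h2 : x ∈ X \ Y := Finset.mem_sdiff.2 ⟨hx, hxY⟩
          have h3 : a ∈ X \ Y := Finset.mem_sdiff.2 ⟨haX, haY⟩
          rw [ha', Finset.mem_singleton] at h2 h3
          rw [h2, h3]
        have hsub : insert b (X.erase a) ⊆ Y := by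
          refine Finset.insert_subset (Finset.mem_sdiff.1 hb).1 fun x hx => ?_
          by_contra hxY
          exact (Finset.mem_erase.1 hx).1 (haa x (Finset.mem_erase.1 hx).2 hxY)
        refine hY𝒮 (Finset.eq_of_subset_of_card_le hsub ?_ ▸ hb𝒮)
        rw [(Finset.mem_powersetCard.1 (hmem b hb)).2, hY'.2]
      refine ⟨c, by simpa using hc, ?_⟩
      rw [hcoe, hP]
      have hZ : ∀ x ∈ Y \ X, x ∉ X.erase a := fun x hx h =>
        (Finset.mem_sdiff.1 hx).2 (Finset.mem_of_mem_erase h)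
      exact ⟨hmem c hc, fun h => h𝒮 _ hb𝒮 _ h
        (JohnsonAdj.insert_insert (hZ b hb) (hZ c hc) hcb.symm)⟩
    · refine ⟨b, by simpa using hb, ?_⟩
      rw [hcoe, hP]
      exact ⟨hmem b hb, hb𝒮⟩
  let M : Matroid α := Matroid.ofIsBaseOfFinite E.finite_toSet P
    (by obtain ⟨X, hX⟩ := hex; exact ⟨X, (hP X).2 hX⟩) hexch
    (by
      rintro _ ⟨X, rfl, hX, -⟩
      exact_mod_cast (Finset.mem_powersetCard.1 hX).1)
  have hM : ∀ X : Finset α, M.IsBase X ↔ X ∈ E.powersetCard r ∧ X ∉ 𝒮 := hP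
  refine ⟨M, ⟨rfl, ?_⟩, hM⟩
  obtain ⟨X, hX⟩ := hex
  rw [← ((hM X).2 hX).encard_eq_eRank, Set.encard_coe_eq_coe_finsetCard,
    (Finset.mem_powersetCard.1 hX.1).2]

theorem card_stableFamilies_le [DecidableEq α] {E : Finset α} {r : ℕ} (hr : 0 < r)
    (hrE : r < E.card) : (stableFamilies E r).card ≤ (matroidFinset E r).card := by
  have h𝒮 : ∀ 𝒮 ∈ stableFamilies E r, 𝒮 ⊆ E.powersetCard r ∧ IsStable 𝒮 := by
    intro 𝒮 h
    simpa only [stableFamilies, Finset.mem_filter, Finset.mem_powerset] using h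
  have hM : ∀ 𝒮 : Finset (Finset α), ∃ M : Matroid α, 𝒮 ∈ stableFamilies E r →
      M ∈ MatroidsOn E r ∧ ∀ X : Finset α, M.IsBase X ↔ X ∈ E.powersetCard r ∧ X ∉ 𝒮 := by
    intro 𝒮
    by_cases h : 𝒮 ∈ stableFamilies E r
    · obtain ⟨M, hM⟩ := exists_sparsePaving hr hrE (h𝒮 𝒮 h).2
      exact ⟨M, fun _ => hM⟩
    · exact ⟨Matroid.emptyOn α, fun h' => absurd h' h⟩
  choose M hM using hM
  refine Finset.card_le_card_of_injOn M (fun 𝒮 h => mem_matroidFinset.2 (hM 𝒮 h).1)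
    fun 𝒮 h 𝒮' h' heq => ?_
  have key : ∀ {𝒮 𝒮' : Finset (Finset α)}, 𝒮 ∈ stableFamilies E r → 𝒮' ∈ stableFamilies E r →
      M 𝒮 = M 𝒮' → 𝒮 ⊆ 𝒮' := by
    intro 𝒮 𝒮' h h' heq X hX
    by_contra hX'
    have h1 := ((hM 𝒮' h').2 X).2 ⟨(h𝒮 𝒮 h).1 hX, hX'⟩
    rw [← heq] at h1
    exact (((hM 𝒮 h).2 X).1 h1).2 hX
  exact (key h h' heq).antisymm (key h' h heq.symm)

/-- A matroid is given by its family of bases. -/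
theorem card_matroidFinset_le (E : Finset α) (r : ℕ) :
    (matroidFinset E r).card ≤ 2 ^ E.card.choose r := by
  classical
  rw [← Finset.card_powersetCard, ← Finset.card_powerset]
  refine Finset.card_le_card_of_injOn
    (fun M => {X ∈ E.powersetCard r | M.IsBase (X : Set α)})
    (fun M _ => Finset.mem_coe.2 (Finset.mem_powerset.2 (Finset.filter_subset _ _)))
    fun M hM N hN h => ?_
  have hM' := mem_matroidFinset.1 (Finset.mem_coe.1 hM)
  have hN' := mem_matroidFinset.1 (Finset.mem_coe.1 hN)
  have h' := fun X => Finset.ext_iff.1 h X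
  simp only [Finset.mem_filter] at h'
  refine MatroidsOn.ext hM' hN' fun X => ⟨fun hX => ?_, fun hX => ?_⟩
  · exact ((h' X).1 ⟨MatroidsOn.isBase_card hM' hX, hX⟩).2
  · exact ((h' X).2 ⟨MatroidsOn.isBase_card hN' hX, hX⟩).2

theorem choose_le_card_boundedSubsets (E : Finset α) {r s : ℕ} (hr : r ≤ s ∨ E.card ≤ r + s) :
    E.card.choose r ≤ (boundedSubsets E s).card := by
  have key : ∀ k ≤ s, E.card.choose k ≤ (boundedSubsets E s).card := by
    intro k hk
    rw [← Finset.card_powersetCard]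
    refine Finset.card_le_card fun X hX => ?_
    rw [Finset.mem_powersetCard] at hX
    exact mem_boundedSubsets.2 ⟨hX.1, hX.2.le.trans hk⟩
  rcases hr with hr | hr
  · exact key r hr
  · rcases le_or_gt r E.card with h | h
    · rw [← Nat.choose_symm h]
      exact key _ (by omega)
    · simp [Nat.choose_eq_zero_of_lt h]

end

/-- The `r`-subsets of `{1, …, n}` whose sum lies in a fixed residue class modulo `n` form a stable
set. -/
theorem isStable_filter_sum_mod (n r a : ℕ) :
    IsStable {X ∈ (Finset.Icc 1 n).powersetCard r | (∑ x ∈ X, x) % n = a} := by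
  rintro X hX _ hY ⟨u, hu, v, hv, rfl⟩
  simp only [Finset.mem_filter, Finset.mem_powersetCard] at hX hY
  have huE := Finset.mem_Icc.1 (hX.1.1 hu)
  have hvE := Finset.mem_Icc.1 (hY.1.1 (Finset.mem_insert_self _ _))
  have h1 : (∑ x ∈ X.erase u, x) + u = ∑ x ∈ X, x := Finset.sum_erase_add _ _ hu
  have h2 : ∑ x ∈ insert v (X.erase u), x = v + ∑ x ∈ X.erase u, x :=
    Finset.sum_insert fun h => hv (Finset.mem_of_mem_erase h)
  have hmod : u ≡ v [MOD n] := by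
    refine Nat.ModEq.add_left_cancel' (∑ x ∈ X.erase u, x) ?_
    rw [h1, add_comm _ v, ← h2]
    exact hX.2.trans hY.2.symm
  have : u = v := by
    have h3 : u - 1 ≡ v - 1 [MOD n] := by
      refine Nat.ModEq.add_right_cancel' 1 ?_
      rwa [Nat.sub_add_cancel huE.1, Nat.sub_add_cancel hvE.1]
    have := Nat.ModEq.eq_of_lt_of_lt h3 (by omega) (by omega)
    omega
  exact hv (this ▸ hu)

/-- The bound of Graham and Sloane: some residue class of sums contains at least a fraction `1 / n`
of all `r`-subsets, and all its subfamilies are stable. -/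
theorem exists_two_pow_le_card_stableFamilies {n : ℕ} (hn : 0 < n) (r : ℕ) :
    ∃ k, n.choose r ≤ n * k ∧ 2 ^ k ≤ (stableFamilies (Finset.Icc 1 n) r).card := by
  obtain ⟨a, -, ha⟩ := Finset.exists_le_card_fiber_of_nsmul_le_card_of_maps_to (M := ℝ)
    (s := (Finset.Icc 1 n).powersetCard r) (t := Finset.range n)
    (f := fun X => (∑ x ∈ X, x) % n) (b := (n.choose r : ℝ) / n)
    (fun X _ => Finset.mem_range.2 (Nat.mod_lt _ hn)) ⟨0, Finset.mem_range.2 hn⟩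
    (by
      rw [Finset.card_range, Finset.card_powersetCard, Nat.card_Icc, nsmul_eq_mul,
        mul_div_cancel₀ _ (by positivity), Nat.add_sub_cancel])
  refine ⟨{X ∈ (Finset.Icc 1 n).powersetCard r | (∑ x ∈ X, x) % n = a}.card, ?_, ?_⟩
  · rw [div_le_iff₀' (by positivity)] at ha
    exact_mod_cast ha
  · rw [← Finset.card_powerset]
    refine Finset.card_le_card fun 𝒮 h𝒮 => ?_
    rw [Finset.mem_powerset] at h𝒮
    simp only [stableFamilies, Finset.mem_filter, Finset.mem_powerset]
    exact ⟨h𝒮.trans (Finset.filter_subset _ _), fun X hX Y hY =>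
      isStable_filter_sum_mod n r a X (h𝒮 hX) Y (h𝒮 hY)⟩

/-! ### Estimates for the terms of the count -/

section
variable {α : Type*}

open Classical in
theorem card_exists_isLoop_mul_two_pow_le (E : Finset α) (r : ℕ) :
    {M ∈ matroidFinset E r | ∃ e, M.IsLoop e}.card * 2 ^ r ≤
      E.card * (matroidFinset E r).card := by
  have hsub : {M ∈ matroidFinset E r | ∃ e, M.IsLoop e} ⊆
      E.biUnion fun e => {M ∈ matroidFinset E r | M.IsLoop e} := by
    intro M hM
    obtain ⟨hM, e, he⟩ := Finset.mem_filter.1 hM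
    refine Finset.mem_biUnion.2 ⟨e, ?_, Finset.mem_filter.2 ⟨hM, he⟩⟩
    have := he.mem_ground
    rwa [(mem_matroidFinset.1 hM).1] at this
  calc _ ≤ (∑ e ∈ E, {M ∈ matroidFinset E r | M.IsLoop e}.card) * 2 ^ r :=
        Nat.mul_le_mul_right _ ((Finset.card_le_card hsub).trans Finset.card_biUnion_le)
    _ = ∑ e ∈ E, {M ∈ matroidFinset E r | M.IsLoop e}.card * 2 ^ r := Finset.sum_mul _ _ _
    _ ≤ ∑ e ∈ E, (matroidFinset E r).card :=
        Finset.sum_le_sum fun e _ => card_isLoop_mul_two_pow_le E r e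
    _ = _ := by simp

open Classical in
theorem card_exists_isColoop_mul_two_pow_le (E : Finset α) (r : ℕ) :
    {M ∈ matroidFinset E r | ∃ e, M.IsColoop e}.card * 2 ^ (E.card - r) ≤
      E.card * (matroidFinset E (E.card - r)).card := by
  refine le_trans (Nat.mul_le_mul_right _ ?_) (card_exists_isLoop_mul_two_pow_le E (E.card - r))
  refine Finset.card_le_card_of_injOn (fun M => M✶) (fun M hM => ?_)
    fun M _ N _ h => Matroid.dual_inj.1 h
  obtain ⟨hM, e, he⟩ := Finset.mem_filter.1 (Finset.mem_coe.1 hM)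
  exact Finset.mem_coe.2 (Finset.mem_filter.2
    ⟨mem_matroidFinset.2 (MatroidsOn.dual (mem_matroidFinset.1 hM)), e, he.dual_isLoop⟩)

theorem fullSignature_mem [DecidableEq α] {E : Finset α} {r s q : ℕ} {M : Matroid α}
    (hM : M ∈ MatroidsOn E r) (hs : 0 < s)
    (hq : 2 * E.card.choose (E.card / 2) / (s * s) ≤ q) :
    fullSignature M E s ∈ signatureRange E r s q ×ˢ signatureRange E (E.card - r) s q :=
  Finset.mem_product.2 ⟨signature_mem_signatureRange hM hs hq,
    signature_mem_signatureRange (MatroidsOn.dual hM) hs hq⟩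

end

theorem matroidsOn_Icc (n r : ℕ) : MatroidsOn (Finset.Icc 1 n) r = matroidsOfRank n r := by
  simp [MatroidsOn, matroidsOfRank]

theorem card_matroidFinset_le_numMatroids (n r : ℕ) :
    (matroidFinset (Finset.Icc 1 n) r).card ≤ numMatroids n := by
  rw [numMatroids, ← Set.ncard_coe_finset]
  refine Set.ncard_le_ncard (fun M hM => ?_) (matroids_finite n)
  have := mem_matroidFinset.1 (Finset.mem_coe.1 hM)
  rw [matroidsOn_Icc] at this
  exact this.1

theorem numMatroids_pos (n : ℕ) : 0 < numMatroids n :=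
  (Set.ncard_pos (matroids_finite n)).2 ⟨Matroid.freeOn (Set.Icc 1 n), rfl⟩

/-- The lower bound `log m(n) ≥ (n choose n/2) / n`. -/
theorem choose_div_le_logb_numMatroids {n : ℕ} (hn : 2 ≤ n) :
    (n.choose (n / 2) : ℝ) / n ≤ Real.logb 2 (numMatroids n) := by
  obtain ⟨k, hk, hk'⟩ := exists_two_pow_le_card_stableFamilies (n := n) (by omega) (n / 2)
  have h1 : 2 ^ k ≤ numMatroids n :=
    hk'.trans ((card_stableFamilies_le (by omega) (by simp; omega)).trans
      (card_matroidFinset_le_numMatroids _ _))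
  have h2 : (k : ℝ) ≤ Real.logb 2 (numMatroids n) := by
    rw [Real.le_logb_iff_rpow_le (by norm_num) (by exact_mod_cast numMatroids_pos n),
      Real.rpow_natCast]
    exact_mod_cast h1
  refine le_trans ?_ h2
  rw [div_le_iff₀' (by positivity)]
  exact_mod_cast hk

theorem one_add_le_two_rpow {x : ℝ} (hx : 0 ≤ x) : 1 + x ≤ 2 ^ (2 * x) := by
  rw [Real.rpow_def_of_pos (by norm_num)]
  have := Real.add_one_le_exp (Real.log 2 * (2 * x))
  nlinarith [Real.log_two_gt_d9]

theorem pow_mul_pow_le_two_rpow {n : ℕ} (hn : 0 < n) (q p : ℕ) :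
    ((n : ℝ) ^ 2) ^ q * (1 + 1 / (n : ℝ) ^ 2) ^ p ≤
      2 ^ (2 * q * Real.logb 2 n + 2 * p / (n : ℝ) ^ 2) := by
  have hn0 : (0 : ℝ) < n := by exact_mod_cast hn
  have h1 : (n : ℝ) = 2 ^ Real.logb 2 n :=
    (Real.rpow_logb (by norm_num) (by norm_num) hn0).symm
  rw [Real.rpow_add (by norm_num)]
  refine mul_le_mul (le_of_eq ?_) ?_ (by positivity) (by positivity)
  · rw [mul_comm, Real.rpow_mul (by norm_num), ← h1, ← pow_mul, ← Real.rpow_natCast]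
    push_cast
    rfl
  · calc (1 + 1 / (n : ℝ) ^ 2) ^ p ≤ (2 ^ (2 * (1 / (n : ℝ) ^ 2))) ^ p :=
          pow_le_pow_left₀ (by positivity) (one_add_le_two_rpow (by positivity)) _
      _ = _ := by
          rw [← Real.rpow_natCast, ← Real.rpow_mul (by norm_num)]
          congr 1
          ring

/-- A set of size `n` has at most `(3 / 2) ^ n` subsets of size at most `n / 8`. -/
theorem card_boundedSubsets_div_eight_le {β : Type*} (E : Finset β) :
    ((boundedSubsets E (E.card / 8)).card : ℝ) ≤ (3 / 2) ^ E.card := by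
  refine (card_boundedSubsets_le E (E.card / 8) (y := 4) (by norm_num)).trans ?_
  have h : (4 : ℝ) ^ (E.card / 8) ≤ (6 / 5) ^ E.card :=
    calc (4 : ℝ) ^ (E.card / 8) ≤ ((6 / 5) ^ 8) ^ (E.card / 8) :=
          pow_le_pow_left₀ (by norm_num) (by norm_num) _
      _ = (6 / 5) ^ (8 * (E.card / 8)) := (pow_mul _ _ _).symm
      _ ≤ _ := pow_le_pow_right₀ (by norm_num) (Nat.mul_div_le _ _)
  calc (4 : ℝ) ^ (E.card / 8) * (1 + 1 / 4) ^ E.card ≤ (6 / 5) ^ E.card * (1 + 1 / 4) ^ E.card := by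
        gcongr
    _ = _ := by rw [← mul_pow]; norm_num

theorem two_pow_le_mul_choose_middle (n : ℕ) : 2 ^ n ≤ (n + 1) * n.choose (n / 2) := by
  rw [← Nat.sum_range_choose]
  refine (Finset.sum_le_card_nsmul _ _ _ fun k _ => Nat.choose_le_middle k n).trans ?_
  simp

theorem cube_le_choose_middle {n : ℕ} (hn : 2 ≤ n) (h : n ^ 3 ≤ 2 ^ (n / 8)) :
    n ^ 3 ≤ n.choose (n / 2) := by
  have h1 := two_pow_le_mul_choose_middle n
  have h2 : 2 ^ (n / 8) * 2 ^ (n / 8) ≤ 2 ^ n := by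
    rw [← pow_add]
    exact Nat.pow_le_pow_right (by norm_num) (by omega)
  have h3 : n + 1 ≤ n ^ 3 := by nlinarith [Nat.mul_le_mul hn hn]
  refine Nat.le_of_mul_le_mul_left (?_ : (n + 1) * n ^ 3 ≤ (n + 1) * _) n.succ_pos
  calc (n + 1) * n ^ 3 ≤ n ^ 3 * n ^ 3 := Nat.mul_le_mul_right _ h3
    _ ≤ 2 ^ (n / 8) * 2 ^ (n / 8) := Nat.mul_le_mul h h
    _ ≤ _ := h2.trans h1

theorem sq_mul_card_boundedSubsets_le {β : Type*} {E : Finset β} {n : ℕ} (hE : E.card = n)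
    (hn : 2 ≤ n) (h : n ^ 3 ≤ 2 ^ (n / 8)) :
    (n : ℝ) ^ 2 * (boundedSubsets E (n / 8)).card ≤ n.choose (n / 2) := by
  have hn' : (2 : ℝ) ≤ n := by exact_mod_cast hn
  have h0 := card_boundedSubsets_div_eight_le E
  rw [hE] at h0
  have h1 : (2 : ℝ) ^ n ≤ (n + 1) * n.choose (n / 2) := by
    exact_mod_cast two_pow_le_mul_choose_middle n
  have hc : (n : ℝ) ^ 3 ≤ 2 ^ (n / 8) := by exact_mod_cast h
  have h2 : (2 : ℝ) ^ (n / 8) * 2 ^ (n / 8) ≤ (4 / 3) ^ n :=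
    calc (2 : ℝ) ^ (n / 8) * 2 ^ (n / 8) = 4 ^ (n / 8) := by rw [← mul_pow]; norm_num
      _ ≤ ((4 / 3) ^ 8) ^ (n / 8) := pow_le_pow_left₀ (by norm_num) (by norm_num) _
      _ = (4 / 3) ^ (8 * (n / 8)) := (pow_mul _ _ _).symm
      _ ≤ _ := pow_le_pow_right₀ (by norm_num) (Nat.mul_div_le _ _)
  have h3 : (n : ℝ) + 1 ≤ n ^ 3 := by nlinarith [mul_le_mul hn' hn' (by norm_num) (by linarith)]
  have h4 : (n : ℝ) ^ 2 ≤ n ^ 3 := pow_le_pow_right₀ (by linarith) (by norm_num)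
  refine le_of_mul_le_mul_left ?_ (show (0 : ℝ) < n + 1 by linarith)
  calc ((n : ℝ) + 1) * ((n : ℝ) ^ 2 * (boundedSubsets E (n / 8)).card)
      ≤ (n : ℝ) ^ 3 * ((n : ℝ) ^ 3 * (3 / 2) ^ n) := by gcongr
    _ = (n : ℝ) ^ 3 * n ^ 3 * (3 / 2) ^ n := by ring
    _ ≤ 2 ^ (n / 8) * 2 ^ (n / 8) * (3 / 2) ^ n := by gcongr
    _ ≤ (4 / 3) ^ n * (3 / 2) ^ n := by gcongr
    _ = 2 ^ n := by rw [← mul_pow]; norm_num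
    _ ≤ _ := h1

theorem eventually_cube_le_two_pow : ∀ᶠ n : ℕ in atTop, n ^ 3 ≤ 2 ^ (n / 8) := by
  have h1 : ∀ᶠ s : ℕ in atTop, (s : ℝ) ^ 3 / 2 ^ s < 1 / 4096 :=
    (tendsto_pow_const_div_const_pow_of_one_lt 3 (by norm_num : (1 : ℝ) < 2)).eventually_lt_const
      (by norm_num)
  have h2 := (Nat.tendsto_div_const_atTop (by norm_num : (8 : ℕ) ≠ 0)).eventually h1
  filter_upwards [h2, eventually_ge_atTop 8] with n hn hn8
  rw [div_lt_div_iff₀ (by positivity) (by norm_num)] at hn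
  have h3 : (n / 8) ^ 3 * 4096 < 1 * 2 ^ (n / 8) := by exact_mod_cast hn
  calc n ^ 3 ≤ (16 * (n / 8)) ^ 3 := Nat.pow_le_pow_left (by omega) 3
    _ ≤ _ := by rw [mul_pow]; omega

/-! ### The count in a fixed rank -/

/-- The number of signatures for `s = n / 8` is `2 ^ O(N ℓ / n ^ 2)`, where `N` is the central
binomial coefficient and `ℓ` the logarithm of `n`. -/
theorem card_signatureRange_le_two_rpow {E : Finset ℕ} {n : ℕ} (hE : E.card = n) (r : ℕ)
    (hℓ : 20000 ≤ Real.logb 2 n) (h3 : n ^ 3 ≤ 2 ^ (n / 8)) (hn : 16 ≤ n) :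
    ((signatureRange E r (n / 8) (2 * n.choose (n / 2) / (n / 8 * (n / 8)))).card : ℝ) ≤
      2 ^ (2053 * (n.choose (n / 2) / (n : ℝ) ^ 2) * Real.logb 2 n) := by
  have hn0 : (0 : ℝ) < n := by positivity
  set ℓ := Real.logb 2 n
  set q := 2 * n.choose (n / 2) / (n / 8 * (n / 8)) with hq
  have hA := sq_mul_card_boundedSubsets_le hE (by omega) h3
  rw [mul_comm, ← le_div_iff₀ (by positivity)] at hA
  have hq' : (q : ℝ) ≤ 512 * (n.choose (n / 2) / (n : ℝ) ^ 2) := by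
    have h1 : q * (n / 8 * (n / 8)) ≤ 2 * n.choose (n / 2) := Nat.div_mul_le_self _ _
    have h2 : n * n ≤ 256 * (n / 8 * (n / 8)) := by
      have : n ≤ 16 * (n / 8) := by omega
      calc n * n ≤ 16 * (n / 8) * (16 * (n / 8)) := Nat.mul_le_mul this this
        _ = _ := by ring
    have h4 : q * (n * n) ≤ 512 * n.choose (n / 2) := by
      calc q * (n * n) ≤ q * (256 * (n / 8 * (n / 8))) := Nat.mul_le_mul_left _ h2
        _ = 256 * (q * (n / 8 * (n / 8))) := by ring
        _ ≤ 256 * (2 * n.choose (n / 2)) := Nat.mul_le_mul_left _ h1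
        _ = _ := by ring
    rw [← mul_div_assoc, le_div_iff₀ (by positivity), sq]
    exact_mod_cast h4
  set x := (n.choose (n / 2) : ℝ) / (n : ℝ) ^ 2 with hx
  have hx0 : 0 ≤ x := by positivity
  refine (card_signatureRange_le E r (n / 8) (y := (n : ℝ) ^ 2) ?_).trans ?_
  · have : (1 : ℝ) ≤ n := by exact_mod_cast (by omega : 1 ≤ n)
    exact one_le_pow₀ this
  rw [hE]
  calc _ ≤ (2 : ℝ) ^ (boundedSubsets E (n / 8)).card *
        (2 ^ (2 * q * ℓ + 2 * (n.choose (n / 2) : ℕ) / (n : ℝ) ^ 2)) ^ 2 := by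
        gcongr
        exact pow_mul_pow_le_two_rpow (by omega) q _
    _ = 2 ^ ((boundedSubsets E (n / 8)).card + (4 * q * ℓ + 4 * x)) := by
        rw [Real.rpow_add (by norm_num) (_ : ℝ) (4 * q * ℓ + 4 * x), Real.rpow_natCast, sq,
          ← Real.rpow_add (by norm_num)]
        congr 2
        rw [hx]
        ring
    _ ≤ _ := by
        refine Real.rpow_le_rpow_of_exponent_le (by norm_num) ?_
        have : (q : ℝ) * ℓ ≤ 512 * x * ℓ := mul_le_mul_of_nonneg_right hq' (by linarith)
        nlinarith

set_option maxHeartbeats 400000 in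
open Classical in
/-- For all large `n`, the matroids of a given rank whose circuit-hyperplanes take few values make
up a fraction `O(n⁻²)` of all matroids. -/
theorem sq_mul_card_le {n r : ℕ} (hrn : r ≤ n)
    (hℓ : 20000 ≤ Real.logb 2 n) (h3 : n ^ 3 ≤ 2 ^ (n / 8)) (hn : 16 ≤ n)
    {K : Finset (Matroid ℕ)} (hK : K ⊆ matroidFinset (Finset.Icc 1 n) r)
    (hW : ((K.image circuitHyperplanes).card : ℝ) ≤
      2 ^ ((1 - Real.logb 2 n ^ 3 / n) * Real.logb 2 (numMatroids n))) :
    (n : ℝ) ^ 2 * K.card ≤ 4 * numMatroids n := by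
  set E := Finset.Icc 1 n with hEdef
  have hE : E.card = n := by simp [E]
  have hsig := fun r' => card_signatureRange_le_two_rpow hE r' hℓ h3 hn
  set ℓ := Real.logb 2 n
  set L := Real.logb 2 (numMatroids n)
  set m := numMatroids n with hm
  have hn0 : (0 : ℝ) < n := by positivity
  have hmL : (m : ℝ) = 2 ^ L :=
    (Real.rpow_logb (by norm_num) (by norm_num) (by exact_mod_cast numMatroids_pos n)).symm
  have hnℓ : (n : ℝ) ^ 2 = 2 ^ (2 * ℓ) := by
    rw [mul_comm, Real.rpow_mul (by norm_num), Real.rpow_logb (by norm_num) (by norm_num) hn0]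
    norm_num
  have hA := sq_mul_card_boundedSubsets_le hE (by omega) h3
  rw [mul_comm, ← le_div_iff₀ (by positivity)] at hA
  set x := (n.choose (n / 2) : ℝ) / (n : ℝ) ^ 2 with hx
  have hℓn : ℓ ≤ n := by
    refine (Real.logb_le_iff_le_rpow (by norm_num) hn0).2 ?_
    rw [Real.rpow_natCast]
    exact_mod_cast Nat.lt_two_pow_self.le
  have hxn : (n : ℝ) ≤ x := by
    rw [hx, le_div_iff₀ (by positivity)]
    have := cube_le_choose_middle (by omega) h3
    calc (n : ℝ) * n ^ 2 = (n : ℝ) ^ 3 := by ring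
      _ ≤ _ := by exact_mod_cast this
  have hxL : n * x ≤ L := by
    refine le_trans (le_of_eq ?_) (choose_div_le_logb_numMatroids (by omega))
    rw [hx]
    field_simp
  have hn16 : (16 : ℝ) ≤ n := by exact_mod_cast hn
  have hrank : ∀ r', ((matroidFinset E r').card : ℝ) ≤ m := fun r' => by
    exact_mod_cast card_matroidFinset_le_numMatroids n r'
  -- It suffices to bound the logarithm of a cardinality by `log m(n) - 2 log n`.
  have hfin : ∀ {c z : ℝ}, c ≤ 2 ^ z → z + 2 * ℓ ≤ L → (n : ℝ) ^ 2 * c ≤ m := by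
    intro c z hc hz
    calc (n : ℝ) ^ 2 * c ≤ 2 ^ (2 * ℓ) * 2 ^ z := by rw [hnℓ]; gcongr
      _ = 2 ^ (z + 2 * ℓ) := by rw [← Real.rpow_add (by norm_num), add_comm]
      _ ≤ _ := by rw [hmL]; exact Real.rpow_le_rpow_of_exponent_le (by norm_num) hz
  have hm0 : (0 : ℝ) ≤ m := by positivity
  clear_value E m L x
  have hx0 : 0 < x := by linarith
  have hℓ0 : 0 < ℓ := by linarith
  by_cases hr : r ≤ n / 8 ∨ n ≤ r + n / 8
  · have h1 : (K.card : ℝ) ≤ 2 ^ x := by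
      calc (K.card : ℝ) ≤ 2 ^ E.card.choose r := by
            have := (Finset.card_le_card hK).trans (card_matroidFinset_le E r)
            simpa only [Nat.cast_pow, Nat.cast_ofNat] using (Nat.cast_le (α := ℝ)).2 this
        _ ≤ 2 ^ (boundedSubsets E (n / 8)).card :=
            pow_le_pow_right₀ (by norm_num) (choose_le_card_boundedSubsets E (by rwa [hE]))
        _ ≤ _ := by
            rw [← Real.rpow_natCast]
            exact Real.rpow_le_rpow_of_exponent_le (by norm_num) hA
    have := hfin h1 (by nlinarith)
    linarith
  · push Not at hr
    set q := 2 * n.choose (n / 2) / (n / 8 * (n / 8)) with hq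
    set 𝒯 := signatureRange E r (n / 8) q ×ˢ signatureRange E (E.card - r) (n / 8) q with h𝒯
    have hK' : ∀ M ∈ K, M ∈ MatroidsOn E r := fun M hM => mem_matroidFinset.1 (hK hM)
    have hmem : ∀ M ∈ K, fullSignature M E (n / 8) ∈ 𝒯 := fun M hM =>
      fullSignature_mem (hK' M hM) (by omega) (by rw [hE])
    have h𝒯c : (𝒯.card : ℝ) ≤ 2 ^ (4106 * x * ℓ) := by
      rw [h𝒯, Finset.card_product, Nat.cast_mul]
      refine (mul_le_mul (hsig _) (hsig _) (by positivity) (by positivity)).trans (le_of_eq ?_)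
      rw [← Real.rpow_add (by norm_num)]
      congr 1
      ring
    -- The threshold `t` exceeds the logarithm of the number of signatures by at least `2 ℓ`.
    set t := ⌈4110 * x * ℓ⌉₊ with ht
    have ht1 : 4110 * x * ℓ ≤ t := Nat.le_ceil _
    have hxℓ : ℓ ≤ x * ℓ := by nlinarith
    have ht2 : t ≤ 4111 * x * ℓ := by
      have := Nat.ceil_lt_add_one (show 0 ≤ 4110 * x * ℓ by positivity)
      linarith
    set K₁ := {M ∈ matroidFinset E r | ∃ e, M.IsLoop e} with hK₁
    set K₂ := {M ∈ matroidFinset E r | ∃ e, M.IsColoop e} with hK₂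
    set K₃ := {M ∈ K | t ≤ (freeRepresentatives E r (n / 8) M).card} with hK₃
    set K₄ := {M ∈ K | (freeRepresentatives E r (n / 8) M).card ≤ t ∧
      (∀ e, ¬ M.IsLoop e) ∧ ∀ e, ¬ M.IsColoop e} with hK₄
    have hsub : K ⊆ (K₁ ∪ K₂) ∪ (K₃ ∪ K₄) := by
      intro M hM
      have hM' := hK hM
      simp only [hK₁, hK₂, hK₃, hK₄, Finset.mem_union, Finset.mem_filter, hM, hM', true_and]
      rcases le_total t (freeRepresentatives E r (n / 8) M).card with h | h
      · exact Or.inr (Or.inl h)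
      · by_cases hl : ∃ e, M.IsLoop e
        · exact Or.inl (Or.inl hl)
        · by_cases hc : ∃ e, M.IsColoop e
          · exact Or.inl (Or.inr hc)
          · exact Or.inr (Or.inr ⟨h, not_exists.1 hl, not_exists.1 hc⟩)
    have hcard : K.card ≤ (K₁.card + K₂.card) + (K₃.card + K₄.card) :=
      (Finset.card_le_card hsub).trans ((Finset.card_union_le _ _).trans
        (add_le_add (Finset.card_union_le _ _) (Finset.card_union_le _ _)))
    have hloop : ∀ {k j a : ℕ}, n / 8 ≤ j → k * 2 ^ j ≤ n * a → (a : ℝ) ≤ m →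
        (n : ℝ) ^ 2 * k ≤ m := by
      intro k j a hj hk ha
      have h1 : n * (n ^ 2 * k) ≤ n * a :=
        calc n * (n ^ 2 * k) = k * n ^ 3 := by ring
          _ ≤ k * 2 ^ j := Nat.mul_le_mul_left _ (h3.trans (Nat.pow_le_pow_right (by norm_num) hj))
          _ ≤ _ := hk
      have h2 : n ^ 2 * k ≤ a := Nat.le_of_mul_le_mul_left h1 (by omega)
      exact le_trans (by exact_mod_cast h2) ha
    have b₁ : (n : ℝ) ^ 2 * K₁.card ≤ m := by
      have := card_exists_isLoop_mul_two_pow_le E r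
      rw [hE] at this
      exact hloop hr.1.le this (hrank _)
    have b₂ : (n : ℝ) ^ 2 * K₂.card ≤ m := by
      have := card_exists_isColoop_mul_two_pow_le E r
      rw [hE] at this
      exact hloop (by omega) this (hrank _)
    have b₃ : (n : ℝ) ^ 2 * K₃.card ≤ m := by
      have h1 := card_mul_two_pow_le (K := K₃) (s := n / 8) (t := t)
        (fun M hM => hK' M (Finset.mem_filter.1 hM).1) (fun M hM => (Finset.mem_filter.1 hM).2)
        (fun M hM => hmem M (Finset.mem_filter.1 hM).1)
      have h2 : ((stableFamilies E r).card : ℝ) ≤ 2 ^ L := by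
        rw [← hmL]
        refine le_trans ?_ (hrank r)
        exact_mod_cast card_stableFamilies_le (by omega) (by omega)
      have h4 : (K₃.card : ℝ) * 2 ^ (t : ℝ) ≤ 2 ^ (4106 * x * ℓ) * 2 ^ L := by
        rw [Real.rpow_natCast]
        calc (K₃.card : ℝ) * 2 ^ t ≤ 𝒯.card * (stableFamilies E r).card := by
              simpa only [Nat.cast_mul, Nat.cast_pow, Nat.cast_ofNat] using
                (Nat.cast_le (α := ℝ)).2 h1
          _ ≤ _ := by gcongr
      rw [← Real.rpow_add (by norm_num), ← le_div_iff₀ (by positivity),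
        ← Real.rpow_sub (by norm_num)] at h4
      exact hfin h4 (by linarith)
    have b₄ : (n : ℝ) ^ 2 * K₄.card ≤ m := by
      have h1 := card_le_mul_card_image_circuitHyperplanes (K := K₄) (s := n / 8) (t := t)
        (fun M hM => hK' M (Finset.mem_filter.1 hM).1)
        (fun M hM => (Finset.mem_filter.1 hM).2.2.1) (fun M hM => (Finset.mem_filter.1 hM).2.2.2)
        (fun M hM => (Finset.mem_filter.1 hM).2.1)
        (fun M hM => hmem M (Finset.mem_filter.1 hM).1)
      have h2 : ((K₄.image circuitHyperplanes).card : ℝ) ≤ 2 ^ ((1 - ℓ ^ 3 / n) * L) := by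
        refine le_trans ?_ hW
        exact_mod_cast Finset.card_le_card (Finset.image_subset_image (Finset.filter_subset _ _))
      have h4 : ((boundedSubsets (E.powersetCard r) t).card : ℝ) ≤ 2 ^ (2 * t * ℓ + 2 * x) := by
        refine (card_boundedSubsets_le _ _ (y := (n : ℝ) ^ 2)
          (one_le_pow₀ (by linarith))).trans ?_
        refine (pow_mul_pow_le_two_rpow (by omega) _ _).trans
          (Real.rpow_le_rpow_of_exponent_le (by norm_num) ?_)
        rw [Finset.card_powersetCard, hE, hx, mul_div_assoc]
        gcongr
        exact Nat.choose_le_middle r n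
      have h5 : (K₄.card : ℝ) ≤
          2 ^ ((1 - ℓ ^ 3 / n) * L + (4106 * x * ℓ + (2 * t * ℓ + 2 * x))) := by
        rw [Real.rpow_add (by norm_num), Real.rpow_add (by norm_num)]
        calc (K₄.card : ℝ) ≤ (K₄.image circuitHyperplanes).card *
              (𝒯.card * (boundedSubsets (E.powersetCard r) t).card) := by
              simpa only [Nat.cast_mul] using (Nat.cast_le (α := ℝ)).2 h1
          _ ≤ _ := by gcongr
      refine hfin h5 ?_
      -- The saving `ℓ ^ 3 / n * L ≥ x * ℓ ^ 3` beats all other terms, which are `O(x * ℓ ^ 2)`, by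
      -- a factor `ℓ`.
      have h6 : ℓ ^ 3 / n * (n * x) ≤ ℓ ^ 3 / n * L := by gcongr
      have h7 : ℓ ^ 3 / n * (n * x) = ℓ ^ 3 * x := by field_simp
      have h8 : t * ℓ ≤ 4111 * x * ℓ * ℓ := by gcongr
      have h9 : x ≤ x * ℓ := by nlinarith
      have h10 : x * ℓ ≤ x * ℓ * ℓ := by nlinarith [mul_pos hx0 hℓ0]
      have h11 : x * ℓ * ℓ * 20000 ≤ x * ℓ * ℓ * ℓ :=
        mul_le_mul_of_nonneg_left hℓ (by positivity)
      linarith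
    have : (K.card : ℝ) ≤ (K₁.card + K₂.card) + (K₃.card + K₄.card) := by exact_mod_cast hcard
    nlinarith [mul_le_mul_of_nonneg_left this (sq_nonneg (n : ℝ))]

/-! ### Thin classes -/

theorem exists_mem_matroidsOfRank {n : ℕ} {M : Matroid ℕ} (hM : M ∈ matroids n) :
    ∃ r ≤ n, M ∈ matroidsOfRank n r := by
  have h1 := M.eRank_le_encard_ground
  have hE : M.E = ((Finset.Icc 1 n : Finset ℕ) : Set ℕ) := by rw [Finset.coe_Icc]; exact hM
  rw [hE, Set.encard_coe_eq_coe_finsetCard, Nat.card_Icc, Nat.add_sub_cancel] at h1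
  obtain ⟨r, hr⟩ := ENat.ne_top_iff_exists.1 (ne_top_of_le_ne_top (ENat.natCast_ne_top n) h1)
  refine ⟨r, ?_, hM, hr.symm⟩
  rw [← hr] at h1
  exact_mod_cast h1

/-- A class whose circuit-hyperplanes take few values in each rank contains a fraction `O(1 / n)` of
the matroids on `{1, …, n}`. -/
theorem ncard_div_numMatroids_le {n : ℕ} (hℓ : 20000 ≤ Real.logb 2 n) (h3 : n ^ 3 ≤ 2 ^ (n / 8))
    (hn : 16 ≤ n) {𝓜 : Set (Matroid ℕ)}
    (h𝓜 : ∀ r ≤ n, Real.logb 2 ((circuitHyperplanes '' (𝓜 ∩ matroidsOfRank n r)).ncard : ℝ) ≤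
      (1 - Real.logb 2 n ^ 3 / n) * Real.logb 2 (numMatroids n)) :
    ((𝓜 ∩ matroids n).ncard : ℝ) / numMatroids n ≤ 8 / n := by
  classical
  have hn0 : (0 : ℝ) < n := by positivity
  set K : ℕ → Finset (Matroid ℕ) := fun r => {M ∈ matroidFinset (Finset.Icc 1 n) r | M ∈ 𝓜}
  have hKcoe : ∀ r, (K r : Set (Matroid ℕ)) = 𝓜 ∩ matroidsOfRank n r := by
    intro r
    ext M
    simp only [K, Finset.coe_filter, mem_matroidFinset, matroidsOn_Icc, Set.mem_inter_iff,
      Set.mem_ofPred_eq]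
    exact and_comm
  have hK : ∀ r ≤ n, (n : ℝ) ^ 2 * (K r).card ≤ 4 * numMatroids n := by
    intro r hr
    refine sq_mul_card_le hr hℓ h3 hn (Finset.filter_subset _ _) ?_
    have h := h𝓜 r hr
    rw [← hKcoe, ← Finset.coe_image, Set.ncard_coe_finset] at h
    rcases Nat.eq_zero_or_pos ((K r).image circuitHyperplanes).card with h0 | h0
    · rw [h0, Nat.cast_zero]
      positivity
    · exact (Real.logb_le_iff_le_rpow (by norm_num) (by exact_mod_cast h0)).1 h
  have hsum : (𝓜 ∩ matroids n).ncard ≤ ∑ r ∈ Finset.range (n + 1), (K r).card := by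
    refine le_trans ?_ Finset.card_biUnion_le
    rw [← Set.ncard_coe_finset]
    refine Set.ncard_le_ncard (fun M hM => ?_) (Finset.finite_toSet _)
    obtain ⟨r, hr, hMr⟩ := exists_mem_matroidsOfRank hM.2
    have : M ∈ (K r : Set (Matroid ℕ)) := hKcoe r ▸ ⟨hM.1, hMr⟩
    exact Finset.mem_coe.2 (Finset.mem_biUnion.2
      ⟨r, Finset.mem_range.2 (Nat.lt_succ_of_le hr), Finset.mem_coe.1 this⟩)
  have hm : (0 : ℝ) < numMatroids n := by exact_mod_cast numMatroids_pos n
  have h1 : (n : ℝ) ^ 2 * (𝓜 ∩ matroids n).ncard ≤ (n + 1) * (4 * numMatroids n) :=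
    calc (n : ℝ) ^ 2 * (𝓜 ∩ matroids n).ncard
        ≤ (n : ℝ) ^ 2 * ∑ r ∈ Finset.range (n + 1), ((K r).card : ℝ) := by
          gcongr
          exact_mod_cast hsum
      _ = ∑ r ∈ Finset.range (n + 1), (n : ℝ) ^ 2 * (K r).card := Finset.mul_sum _ _ _
      _ ≤ ∑ r ∈ Finset.range (n + 1), 4 * (numMatroids n : ℝ) :=
          Finset.sum_le_sum fun r hr => hK r (Nat.lt_succ_iff.1 (Finset.mem_range.1 hr))
      _ = _ := by simp
  rw [div_le_div_iff₀ hm hn0]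
  refine le_of_mul_le_mul_left ?_ hn0
  have hn1 : (1 : ℝ) ≤ n := by exact_mod_cast (by omega : 1 ≤ n)
  calc (n : ℝ) * ((𝓜 ∩ matroids n).ncard * n) = (n : ℝ) ^ 2 * (𝓜 ∩ matroids n).ncard := by ring
    _ ≤ (n + 1) * (4 * numMatroids n) := h1
    _ ≤ (n + n) * (4 * numMatroids n) := by gcongr
    _ = _ := by ring

end MatroidAsymptotics

theorem corollary1p4 :
    ∃ c : ℝ, 0 < c ∧
      ∀ 𝓜 : Set (Matroid ℕ), 𝓜 ⊆ MatroidAsymptotics.allMatroids →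
        (∀ᶠ n : ℕ in atTop, ∀ r : ℕ, r ≤ n →
          Real.logb 2
              ((MatroidAsymptotics.circuitHyperplanes ''
                (𝓜 ∩ MatroidAsymptotics.matroidsOfRank n r)).ncard : ℝ) ≤
            (1 - c * Real.logb 2 (n : ℝ) ^ 3 / (n : ℝ)) *
              Real.logb 2 (MatroidAsymptotics.numMatroids n : ℝ)) →
        MatroidAsymptotics.Thin 𝓜 := by
  refine ⟨1, one_pos, fun 𝓜 _ h𝓜 => ?_⟩
  have hlog : ∀ᶠ n : ℕ in atTop, 20000 ≤ Real.logb 2 n :=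
    ((Real.tendsto_logb_atTop (by norm_num)).comp tendsto_natCast_atTop_atTop).eventually_ge_atTop _
  refine squeeze_zero' (Eventually.of_forall fun n => by positivity) ?_
    (tendsto_const_div_atTop_nhds_zero_nat (8 : ℝ))
  filter_upwards [h𝓜, hlog, MatroidAsymptotics.eventually_cube_le_two_pow, eventually_ge_atTop 16]
    with n h hℓ h3 hn
  refine MatroidAsymptotics.ncard_div_numMatroids_le hℓ h3 hn fun r hr => ?_
  simpa only [one_mul] using h r hr
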